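/- Let $m\ge 2$, $n=2^m-1$, and let $h(X)\in\mathbb Z_4[X]$ be a primitive basic irreducible polynomial of degree $m$, i.e. $h$ is monic of degree $m$, $h(X)$ divides $X^n-1$ in $\mathbb Z_4[X]$, and $h \bmod 2$ is a primitive irreducible polynomial of degree $m$ over $\mathbb Z_2$ (irreducible, with roots of multiplicative order $2^m-1$). Let $g(X)$ be the reciprocal polynomial of $(X^n-1)/((X-1)h(X))$. Let $\mathcal K^-$ and $\mathcal P^-$ be the cyclic codes of length $n$ over $\mathbb Z_4$ with generator polynomials $g$ and $h$, respectively (the ideals generated by $g$, respectively $h$, in $\mathbb Z_4[X]/(X^n-1)$), and let $\mathcal K$ (the quaternary Kerdock code) and $\mathcal P$ be obtained from $\mathcal K^-$ and $\mathcal P^-$ by adjoining a zero-sum check symbol. Let $\phi:\mathbb Z_4^{n+1}\to\mathbb Z_2^{2(n+1)}$ be the Gray map $\phi(c)=(\beta(c),\gamma(c))$, where $\beta,\gamma:\mathbb Z_4\to\mathbb Z_2$ send $0,1,2,3$ to $0,0,1,1$ and to $0,1,1,0$ and are applied coordinatewise, and put $K=\phi(\mathcal K)$ (the binary Kerdock code)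 and $P=\phi(\mathcal P)$. **Theorem 5.1.** We have $\mathcal P=\mathcal K^\perp$, where $\perp$ is taken with respect to $a\cdot b=\sum_i a_ib_i\in\mathbb Z_4$. If $m\ge3$ is odd, then $P$ is a nonlinear binary code of length $l=2^{m+1}$, with $2^{l-2m-2}$ codewords and minimal Hamming distance $6$. This code is distance invariant: the translates $u+P$, $u\in P$, all have the same Hamming weight distribution. Its weight distribution is the MacWilliams transform of the weight distribution of the Kerdock code $K$ of the same length: with $A_i$ and $B_i$ the numbers of words of Hamming weight $i$ in $K$ and $P$, $$\sum_{i=0}^{l} B_i\,W^{l-i}Z^i=\frac1{|K|}\sum_{i=0}^{l}A_i\,(W+Z)^{l-i}(W-Z)^i .$$ It is also the weight distribution of Preparata's original (extended) code of length $2^{m+1}$, i.e. of the set of all $(b,a+b)$ with $a,b\in\mathbb Z_2^{F}$, $F$ a field with $2^m$ elements, such that $$\sum_{x\in F} a_x=\sum_{x\in F} b_x=0,\qquad \sum_{x\in F}a_x\,x=0,\qquad \Bigl(\sum_{x\in F}b_x\,x\Bigr)^3=\sum_{x\in F}a_x\,x^3 .$$ -/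

import Mathlib

open Polynomial

noncomputable section

namespace QuaternaryCode

/-! ### Quaternary codes: duals, cyclic codes, zero-sum extension -/

/-- A quaternary code with coordinates indexed by `ι`: an additive subgroup of `ℤ₄^ι`,
that is, a `ℤ₄`-submodule. -/
abbrev Code4 (ι : Type*) := Submodule (ZMod 4) (ι → ZMod 4)

/-- The dual code with respect to the inner product `a · b = ∑ aᵢ bᵢ (mod 4)`. -/
def dual {ι : Type*} [Fintype ι] (C : Code4 ι) : Code4 ι where
  carrier := {a | ∀ b ∈ C, a ⬝ᵥ b = 0}
  zero_mem' := fun b _ => zero_dotProduct b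
  add_mem' := fun {a a'} ha ha' b hb => by
    rw [add_dotProduct, ha b hb, ha' b hb, add_zero]
  smul_mem' := fun r a ha b hb => by
    rw [smul_dotProduct, ha b hb, smul_zero]

/-- The identification of `v = (v₀, …, vₙ₋₁)` with the class of `∑ vᵣ X^r` in
`ℤ₄[X] / (X^n - 1)`. -/
def toCyclicRing (n : ℕ) :
    (Fin n → ZMod 4) →ₗ[ZMod 4] AdjoinRoot (X ^ n - 1 : (ZMod 4)[X]) where
  toFun v := ∑ r : Fin n, v r • AdjoinRoot.root (X ^ n - 1 : (ZMod 4)[X]) ^ (r : ℕ)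
  map_add' v w := by simp only [Pi.add_apply, add_smul, Finset.sum_add_distrib]
  map_smul' a v := by
    simp only [Pi.smul_apply, smul_eq_mul, mul_smul, Finset.smul_sum, RingHom.id_apply]

/-- The cyclic code of length `n` over `ℤ₄` with generator polynomial `f`: the words whose
polynomial lies in the ideal generated by `f` in `ℤ₄[X] / (X^n - 1)`. -/
def cyclicCode (n : ℕ) (f : (ZMod 4)[X]) : Code4 (Fin n) :=
  ((Ideal.span {AdjoinRoot.mk (X ^ n - 1 : (ZMod 4)[X]) f}).restrictScalars (ZMod 4)).comap
    (toCyclicRing n)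

/-- Adjoin a zero-sum check symbol; it stands at the coordinate `∞ = none`. -/
def zeroSumExtend (n : ℕ) : (Fin n → ZMod 4) →ₗ[ZMod 4] (Option (Fin n) → ZMod 4) where
  toFun c := fun t => t.elim (-∑ i, c i) c
  map_add' c d := by
    funext t
    cases t
    · simp [Finset.sum_add_distrib, add_comm]
    · simp
  map_smul' a c := by
    funext t
    cases t
    · simp [Finset.mul_sum]
    · simp

/-- The code obtained from a code of length `n` by adjoining a zero-sum check symbol. -/
def extendedCode {n : ℕ} (C : Code4 (Fin n)) : Code4 (Option (Fin n)) :=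
  C.map (zeroSumExtend n)

/-! ### Binary codes (not necessarily linear) -/

/-- The length of a binary code, i.e. its number of coordinates. -/
def blockLength {ι : Type*} [Fintype ι] (_C : Set (ι → ZMod 2)) : ℕ := Fintype.card ι

/-- A binary code is linear if it is a subspace. -/
def IsLinear {ι : Type*} (C : Set (ι → ZMod 2)) : Prop :=
  ∃ S : Submodule (ZMod 2) (ι → ZMod 2), (S : Set (ι → ZMod 2)) = C

/-- `d` is the minimal Hamming distance between distinct words of `C`. -/
def HasMinDistance {ι : Type*} [Fintype ι] (C : Set (ι → ZMod 2)) (d : ℕ) : Prop :=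
  IsLeast {k | ∃ u ∈ C, ∃ v ∈ C, u ≠ v ∧ hammingDist u v = k} d

/-- The Hamming weight distribution `i ↦ Aᵢ`: the number of words of weight `i`. -/
def weightDistribution {ι : Type*} [Fintype ι] (C : Set (ι → ZMod 2)) (i : ℕ) : ℕ :=
  {c | c ∈ C ∧ hammingNorm c = i}.ncard

/-- All translates `u + C`, `u ∈ C`, have the same weight distribution. -/
def IsDistanceInvariant {ι : Type*} [Fintype ι] (C : Set (ι → ZMod 2)) : Prop :=
  ∀ u ∈ C, ∀ v ∈ C,
    weightDistribution ((fun c => u + c) '' C) = weightDistribution ((fun c => v + c) '' C)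

/-- The homogeneous polynomial `∑ᵢ Aᵢ W^(N-i) Z^i` (with `W = X 0`, `Z = X 1`) of a weight
distribution `A` of a code of length `N`. -/
def enumerator (N : ℕ) (A : ℕ → ℕ) : MvPolynomial (Fin 2) ℚ :=
  ∑ i ∈ Finset.range (N + 1),
    MvPolynomial.C (A i : ℚ) * MvPolynomial.X 0 ^ (N - i) * MvPolynomial.X 1 ^ i

/-- The weight distribution `B` is the (binary) MacWilliams transform of the weight distribution
`A`, both for codes of length `N`: `B(W, Z) = |A|⁻¹ A(W + Z, W - Z)`, where `|A| = ∑ᵢ Aᵢ` is the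
number of words of the code. -/
def IsMacWilliamsTransform (N : ℕ) (B A : ℕ → ℕ) : Prop :=
  enumerator N B =
    MvPolynomial.C ((∑ i ∈ Finset.range (N + 1), A i : ℕ) : ℚ)⁻¹ *
      MvPolynomial.aeval
        (![MvPolynomial.X 0 + MvPolynomial.X 1, MvPolynomial.X 0 - MvPolynomial.X 1] :
          Fin 2 → MvPolynomial (Fin 2) ℚ)
        (enumerator N A)

/-! ### The Gray map -/

/-- `β(0), β(1), β(2), β(3) = 0, 0, 1, 1`. -/
def grayBeta : ZMod 4 → ZMod 2 := fun c => if c = 2 ∨ c = 3 then 1 else 0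

/-- `γ(0), γ(1), γ(2), γ(3) = 0, 1, 1, 0`. -/
def grayGamma : ZMod 4 → ZMod 2 := fun c => if c = 1 ∨ c = 2 then 1 else 0

/-- The Gray map `φ(c) = (β(c), γ(c))`; the two halves are the two summands of `ι ⊕ ι`. -/
def gray {ι : Type*} (c : ι → ZMod 4) : ι ⊕ ι → ZMod 2 :=
  Sum.elim (fun i => grayBeta (c i)) (fun i => grayGamma (c i))

/-- The binary image `φ(C)` of a quaternary code. -/
def binaryImage {ι : Type*} (C : Code4 ι) : Set (ι ⊕ ι → ZMod 2) :=
  gray '' (C : Set (ι → ZMod 4))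

/-! ### The quaternary Kerdock and 'Preparata' codes -/

/-- A primitive irreducible polynomial of degree `m` over `ℤ₂`: its root has multiplicative
order `2^m - 1`. -/
def IsPrimitiveIrreducible (m : ℕ) (f : (ZMod 2)[X]) : Prop :=
  f.natDegree = m ∧ Irreducible f ∧ orderOf (AdjoinRoot.root f) = 2 ^ m - 1

/-- A primitive basic irreducible polynomial of degree `m` over `ℤ₄`: a monic polynomial of
degree `m` dividing `X^n - 1`, `n = 2^m - 1`, whose reduction mod 2 is a primitive irreducible
polynomial of degree `m`. -/
structure IsPrimitiveBasicIrreducible (m : ℕ) (h : (ZMod 4)[X]) : Prop where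
  monic : h.Monic
  natDegree_eq : h.natDegree = m
  dvd : h ∣ X ^ (2 ^ m - 1) - 1
  reduction : IsPrimitiveIrreducible m (h.map (ZMod.castHom (by decide : 2 ∣ 4) (ZMod 2)))

/-- The reciprocal polynomial `g` of `(X^n - 1) / ((X - 1) h)`, `n = 2^m - 1`. -/
def kerdockGenerator (m : ℕ) (h : (ZMod 4)[X]) : (ZMod 4)[X] :=
  ((X ^ (2 ^ m - 1) - 1) /ₘ ((X - 1) * h)).reverse

/-- The quaternary Kerdock code: the cyclic code with generator polynomial `g`, extended by a
zero-sum check symbol. -/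
def kerdock (m : ℕ) (h : (ZMod 4)[X]) : Code4 (Option (Fin (2 ^ m - 1))) :=
  extendedCode (cyclicCode (2 ^ m - 1) (kerdockGenerator m h))

/-- The quaternary 'Preparata' code: the cyclic code with generator polynomial `h`, extended by
a zero-sum check symbol. -/
def preparata (m : ℕ) (h : (ZMod 4)[X]) : Code4 (Option (Fin (2 ^ m - 1))) :=
  extendedCode (cyclicCode (2 ^ m - 1) h)

/-! ### Preparata's original binary code -/

/-- The power sum `∑ₓ aₓ x^k` over the support of the binary word `a`. -/
def powerSum {F : Type*} [Field F] [Fintype F] [Algebra (ZMod 2) F]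
    (a : F → ZMod 2) (k : ℕ) : F :=
  ∑ x : F, algebraMap (ZMod 2) F (a x) * x ^ k

/-- Preparata's original (extended) code over a finite field `F` of characteristic 2, in the
description of Baker, van Lint and Wilson: the words `(b, a + b)`, `a, b ∈ ℤ₂^F`, such that `a` and
`b` have even weight, `∑ aₓ x = 0` and `(∑ bₓ x)³ = ∑ aₓ x³`. -/
def originalPreparata (F : Type*) [Field F] [Fintype F] [Algebra (ZMod 2) F] :
    Set (F ⊕ F → ZMod 2) :=
  {c | ∃ a b : F → ZMod 2, c = Sum.elim b (a + b) ∧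
    powerSum a 0 = 0 ∧ powerSum a 1 = 0 ∧ powerSum b 0 = 0 ∧
    powerSum b 1 ^ 3 = powerSum a 3}

end QuaternaryCode

end

open QuaternaryCode

/-!
The length-`2^m` quaternary codes are best seen through the Galois ring `R = ℤ₄[X] / (h)`, its
residue field `R / 2R` with `N = 2^m` elements, and the Teichmüller set `{0} ∪ {ξ^i}` of `R`,
whose elements `tⱼ` index the coordinates. A word `d` lies in `𝒫` iff `∑ dⱼ = 0` and
`∑ dⱼ tⱼ = 0` (`mem_preparata_iff`), while `𝒦` consists of the words `j ↦ ε + λ(tⱼ)` with `ε ∈ ℤ₄`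
and `λ : R → ℤ₄` linear (`kerdock_eq_affineCode`): the cyclic code generated by the reciprocal of
`(X^n - 1) / p` consists of the linear recurring sequences with characteristic polynomial `p`. As
linear functionals separate the points of `R`, this gives `𝒫 = 𝒦^⊥`.

The Hamming distance of `φ(a)` and `φ(b)` is the Lee weight of `b - a`, so that the Gray image of a
quaternary code is distance invariant. The Gray images of dual codes satisfy the MacWilliams
identity (`weightEnum_dual`).

Let `m = 2k + 1`. For `λ` nonzero modulo `2` the sum `∑ i^(λ(tⱼ))` has absolute value `√N`, because
the differences of distinct Teichmüller elements run once through the units of `R`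
(`IsTeichmuller.sub_injective`). An odd power of `2` is a sum of two squares in one way only, so
the real and imaginary parts are `±2^k`. Hence the weights of `K` are `0`, `N ± 2^k`, `N`, `2N`, and
the weight enumerators of `K` and `P` are explicit. The coefficients of the latter up to degree `6`
give the minimal distance, and its value at `(1, 1)` the number of words.

The weight enumerator of Preparata's original code is found from a Fourier expansion of its
indicator, in which the condition `(∑ bₓ x)³ = ∑ aₓ x³` contributes the Walsh transform of the cube
map, up to scaling, at `λ + κ` (`sum_walsh_eq_indicator`). For odd `m` this transform is supported
on the elements of trace `1`, so that only pairs `(λ, κ)` with exactly one element of trace `1` contribute. The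
result is the same polynomial as for `P`.

If `P` were linear, `𝒫` would contain `2ab` for all `a, b ∈ 𝒫`, so that the extended Hamming code
`𝒫 mod 2` would be closed under products; but it contains the planes `{0, 1, u, u + 1}` and
`{0, 1, v, v + 1}`, and their intersection `{0, 1}` is no word of it.
-/

namespace QuaternaryCode

/-! ### Weight enumerators of binary codes -/

/-- The value at `(w, z)` of the homogeneous weight enumerator `∑ w^(l - wt c) z^(wt c)` of a
binary code of length `l`, the sum being over the code words `c`. -/
noncomputable def weightEnum {κ : Type*} [Fintype κ] (C : Set (κ → ZMod 2)) (w z : ℂ) : ℂ :=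
  ∑ c ∈ C.toFinite.toFinset, w ^ (Fintype.card κ - hammingNorm c) * z ^ hammingNorm c

section Binary

variable {κ : Type*} [Fintype κ]

theorem weightEnum_eq_sum_indicator [DecidableEq κ] (C : Set (κ → ZMod 2)) (w z : ℂ) :
    weightEnum C w z =
      ∑ c, C.indicator (fun c => w ^ (Fintype.card κ - hammingNorm c) * z ^ hammingNorm c) c := by
  classical
  rw [Finset.sum_indicator_eq_sum_filter, weightEnum]
  exact Finset.sum_congr (by ext; simp) fun _ _ => rfl

theorem weightEnum_eq_sum (C : Set (κ → ZMod 2)) (w z : ℂ) :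
    weightEnum C w z = ∑ i ∈ Finset.range (Fintype.card κ + 1),
      (weightDistribution C i : ℂ) * w ^ (Fintype.card κ - i) * z ^ i := by
  classical
  rw [weightEnum, ← Finset.sum_fiberwise_of_maps_to (g := fun c : κ → ZMod 2 => hammingNorm c)
    (t := Finset.range (Fintype.card κ + 1))
    (fun c _ => Finset.mem_range_succ_iff.2 hammingNorm_le_card_fintype)]
  refine Finset.sum_congr rfl fun i _ => ?_
  have hcard : weightDistribution C i =
      (C.toFinite.toFinset.filter fun c => hammingNorm c = i).card := by
    rw [weightDistribution, ← Set.ncard_coe_finset]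
    congr 1
    ext c
    simp
  rw [hcard, mul_assoc, ← nsmul_eq_mul, ← Finset.sum_const]
  refine Finset.sum_congr rfl fun c hc => ?_
  rw [(Finset.mem_filter.1 hc).2]

theorem weightDistribution_eq_zero (C : Set (κ → ZMod 2)) {i : ℕ} (hi : Fintype.card κ < i) :
    weightDistribution C i = 0 := by
  rw [weightDistribution, Set.ncard_eq_zero (Set.toFinite _), Set.eq_empty_iff_forall_notMem]
  rintro c ⟨-, rfl⟩
  exact absurd hammingNorm_le_card_fintype (not_le.2 hi)

/-- The dehomogenized weight enumerator, as a polynomial. -/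
noncomputable def weightPoly (C : Set (κ → ZMod 2)) : ℂ[X] :=
  ∑ i ∈ Finset.range (Fintype.card κ + 1), Polynomial.C (weightDistribution C i : ℂ) * X ^ i

theorem eval_weightPoly (C : Set (κ → ZMod 2)) (z : ℂ) :
    (weightPoly C).eval z = weightEnum C 1 z := by
  simp [weightPoly, weightEnum_eq_sum, eval_finsetSum]

theorem coeff_weightPoly (C : Set (κ → ZMod 2)) (i : ℕ) :
    (weightPoly C).coeff i = weightDistribution C i := by
  simp only [weightPoly, finsetSum_coeff, coeff_C_mul, coeff_X_pow, mul_ite, mul_one, mul_zero,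
    Finset.sum_ite_eq, Finset.mem_range]
  split_ifs with h
  · rfl
  · rw [weightDistribution_eq_zero C (by omega), Nat.cast_zero]

theorem weightDistribution_eq_of_weightEnum {κ' : Type*} [Fintype κ'] {C : Set (κ → ZMod 2)}
    {D : Set (κ' → ZMod 2)} (h : ∀ z, weightEnum C 1 z = weightEnum D 1 z) :
    weightDistribution C = weightDistribution D := by
  have hp : weightPoly C = weightPoly D :=
    Polynomial.funext fun z => by rw [eval_weightPoly, eval_weightPoly, h]
  funext i
  exact_mod_cast (coeff_weightPoly C i).symm.trans ((congrArg (coeff · i) hp).trans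
    (coeff_weightPoly D i))

theorem weightEnum_one_one (C : Set (κ → ZMod 2)) : weightEnum C 1 1 = C.ncard := by
  simp [weightEnum, Set.ncard_eq_toFinset_card C]

theorem sum_weightDistribution (C : Set (κ → ZMod 2)) :
    ∑ i ∈ Finset.range (Fintype.card κ + 1), weightDistribution C i = C.ncard := by
  have := (weightEnum_eq_sum C 1 1).symm.trans (weightEnum_one_one C)
  simp only [one_pow, mul_one] at this
  exact_mod_cast this

theorem eval_enumerator (N : ℕ) (A : ℕ → ℕ) (x : Fin 2 → ℚ) :
    ((MvPolynomial.eval x (enumerator N A) : ℚ) : ℂ) =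
      ∑ i ∈ Finset.range (N + 1), (A i : ℂ) * (x 0 : ℂ) ^ (N - i) * (x 1 : ℂ) ^ i := by
  simp [enumerator]

/-- The MacWilliams identity may be checked on the values of the weight enumerators. -/
theorem isMacWilliamsTransform_of_weightEnum {κ' : Type*} [Fintype κ'] {C : Set (κ → ZMod 2)}
    {D : Set (κ' → ZMod 2)} {N : ℕ} (hN : Fintype.card κ = N) (hN' : Fintype.card κ' = N)
    (hD : D.Nonempty)
    (h : ∀ w z, (D.ncard : ℂ) * weightEnum C w z = weightEnum D (w + z) (w - z)) :
    IsMacWilliamsTransform N (weightDistribution C) (weightDistribution D) := by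
  have hD0 : (D.ncard : ℂ) ≠ 0 := by
    exact_mod_cast ((Set.ncard_pos (Set.toFinite D)).2 hD).ne'
  refine MvPolynomial.funext fun x => ?_
  have key := h (x 0) (x 1)
  rw [weightEnum_eq_sum, weightEnum_eq_sum, hN, hN'] at key
  have hsum := sum_weightDistribution D
  rw [hN'] at hsum
  have e2 : MvPolynomial.eval x (MvPolynomial.aeval
        (![MvPolynomial.X 0 + MvPolynomial.X 1, MvPolynomial.X 0 - MvPolynomial.X 1] :
          Fin 2 → MvPolynomial (Fin 2) ℚ) (enumerator N (weightDistribution D))) =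
      MvPolynomial.eval ![x 0 + x 1, x 0 - x 1] (enumerator N (weightDistribution D)) := by
    simp [enumerator]
  rw [map_mul, e2, hsum, MvPolynomial.eval_C]
  have : ((MvPolynomial.eval x (enumerator N (weightDistribution C)) : ℚ) : ℂ) =
      (((D.ncard : ℚ)⁻¹ *
        MvPolynomial.eval ![x 0 + x 1, x 0 - x 1] (enumerator N (weightDistribution D)) : ℚ) : ℂ) :=
      by
    rw [Rat.cast_mul, eval_enumerator, eval_enumerator, Rat.cast_inv, Rat.cast_natCast,
      eq_inv_mul_iff_mul_eq₀ hD0, key]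
    simp
  exact_mod_cast this

/-- The weight enumerator of a Preparata code of length `2N`, where `N = 2^(2k+1)`: the MacWilliams
transform of the weight enumerator of a Kerdock code, which has `1`, `1`, `4N - 2` and twice
`2N(N-1)` words of weight `0`, `2N`, `N` and `N ± 2^k`. -/
def HasPreparataEnumerator (C : Set (κ → ZMod 2)) (k N : ℕ) : Prop :=
  ∀ w z : ℂ, 4 * (N : ℂ) ^ 2 * weightEnum C w z =
    (w + z) ^ (2 * N) + (w - z) ^ (2 * N) + (4 * N - 2) * ((w + z) ^ N * (w - z) ^ N) +
      2 * N * (N - 1) * ((w + z) ^ (N + 2 ^ k) * (w - z) ^ (N - 2 ^ k) +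
        (w + z) ^ (N - 2 ^ k) * (w - z) ^ (N + 2 ^ k))

end Binary

/-! ### The Gray map and the Lee weight -/

/-- The Lee weight on `ℤ₄`: the Hamming weight of the Gray image. -/
def lee (a : ZMod 4) : ℕ := (if grayBeta a ≠ 0 then 1 else 0) + if grayGamma a ≠ 0 then 1 else 0

/-- The real part of `i^a`. -/
def re4 (a : ZMod 4) : ℤ := if a = 0 then 1 else if a = 2 then -1 else 0

/-- The imaginary part of `i^a`. -/
def im4 (a : ZMod 4) : ℤ := if a = 1 then 1 else if a = 3 then -1 else 0

theorem lee_eq (a : ZMod 4) : (lee a : ℤ) = 1 - re4 a := by revert a; decide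

theorem lee_le (a : ZMod 4) : lee a ≤ 2 := by revert a; decide

section Gray

variable {ι : Type*}

theorem gray_injective : Function.Injective (gray : (ι → ZMod 4) → ι ⊕ ι → ZMod 2) := by
  intro c d h
  funext i
  have h1 : grayBeta (c i) = grayBeta (d i) := congrFun h (Sum.inl i)
  have h2 : grayGamma (c i) = grayGamma (d i) := congrFun h (Sum.inr i)
  generalize c i = a at h1 h2 ⊢
  generalize d i = b at h1 h2 ⊢
  revert a b
  decide

theorem gray_add_gray (a b : ι → ZMod 4) : gray a + gray b = gray (a + b + 2 * (a * b)) := by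
  have hb : ∀ a b : ZMod 4, grayBeta a + grayBeta b = grayBeta (a + b + 2 * (a * b)) := by decide
  have hc : ∀ a b : ZMod 4, grayGamma a + grayGamma b = grayGamma (a + b + 2 * (a * b)) := by
    decide
  funext i
  rcases i with i | i
  · exact hb (a i) (b i)
  · exact hc (a i) (b i)

theorem zero_mem_binaryImage (C : Code4 ι) : (0 : ι ⊕ ι → ZMod 2) ∈ binaryImage C :=
  ⟨0, C.zero_mem, by funext i; rcases i with i | i <;> simp [gray, grayBeta, grayGamma] <;> decide⟩

theorem ncard_binaryImage (C : Code4 ι) : (binaryImage C).ncard = (C : Set (ι → ZMod 4)).ncard :=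
  Set.ncard_image_of_injective _ gray_injective

variable [Fintype ι]

theorem hammingNorm_gray (c : ι → ZMod 4) : hammingNorm (gray c) = ∑ i, lee (c i) := by
  classical
  rw [hammingNorm, Finset.card_filter, Fintype.sum_sum_type, ← Finset.sum_add_distrib]
  rfl

theorem sum_lee_eq (c : ι → ZMod 4) :
    ((∑ i, lee (c i) : ℕ) : ℤ) = Fintype.card ι - ∑ i, re4 (c i) := by
  push_cast
  simp [lee_eq]

theorem hammingNorm_gray_add_gray (a b : ι → ZMod 4) :
    hammingNorm (gray a + gray b) = hammingNorm (gray (b - a)) := by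
  have h : ∀ a b : ZMod 4, lee (a + b + 2 * (a * b)) = lee (b - a) := by decide
  rw [gray_add_gray, hammingNorm_gray, hammingNorm_gray]
  exact Finset.sum_congr rfl fun i _ => h (a i) (b i)

theorem weightDistribution_add_image (C : Code4 ι) {u : ι ⊕ ι → ZMod 2} (hu : u ∈ binaryImage C) :
    weightDistribution ((fun c => u + c) '' binaryImage C) =
      weightDistribution (binaryImage C) := by
  obtain ⟨a, ha, rfl⟩ := hu
  funext i
  have hl : {c | c ∈ (fun c => gray a + c) '' binaryImage C ∧ hammingNorm c = i} =
      (fun b => gray a + gray b) '' {b | b ∈ C ∧ hammingNorm (gray (b - a)) = i} := by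
    ext c
    constructor
    · rintro ⟨⟨_, ⟨b, hb, rfl⟩, rfl⟩, h⟩
      exact ⟨b, ⟨hb, by rw [← hammingNorm_gray_add_gray]; exact h⟩, rfl⟩
    · rintro ⟨b, ⟨hb, h⟩, rfl⟩
      exact ⟨⟨_, ⟨b, hb, rfl⟩, rfl⟩, by rw [← h, ← hammingNorm_gray_add_gray]⟩
  have hr : {c | c ∈ binaryImage C ∧ hammingNorm c = i} =
      (fun b => gray (b - a)) '' {b | b ∈ C ∧ hammingNorm (gray (b - a)) = i} := by
    ext c
    constructor
    · rintro ⟨⟨b, hb, rfl⟩, h⟩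
      exact ⟨b + a, ⟨C.add_mem hb ha, by simpa using h⟩, by simp⟩
    · rintro ⟨b, ⟨hb, h⟩, rfl⟩
      exact ⟨⟨b - a, C.sub_mem hb ha, rfl⟩, h⟩
  rw [weightDistribution, weightDistribution, hl, hr,
    Set.ncard_image_of_injective _ fun x y h => gray_injective (add_right_injective _ h),
    Set.ncard_image_of_injective _ fun x y h => sub_left_injective (gray_injective h)]

theorem isDistanceInvariant_binaryImage (C : Code4 ι) : IsDistanceInvariant (binaryImage C) :=
  fun u hu v hv => by
    rw [weightDistribution_add_image C hu, weightDistribution_add_image C hv]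

/-- The Gray image of a quaternary code has as minimal distance the least positive weight. -/
theorem hasMinDistance_binaryImage (C : Code4 ι) {d : ℕ} (hd : 0 < d)
    (h0 : ∀ i, 0 < i → i < d → weightDistribution (binaryImage C) i = 0)
    (h1 : weightDistribution (binaryImage C) d ≠ 0) : HasMinDistance (binaryImage C) d := by
  have hneg : ∀ x : ι ⊕ ι → ZMod 2, -x = x := fun x => by
    funext i; exact (by decide : ∀ a : ZMod 2, -a = a) (x i)
  constructor
  · obtain ⟨c, hc, hw⟩ := Set.nonempty_of_ncard_ne_zero h1
    refine ⟨c, hc, 0, zero_mem_binaryImage C, ?_, ?_⟩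
    · rintro rfl
      simp at hw
      omega
    · rw [hammingDist_zero_right, hw]
  · rintro k ⟨u, hu, v, hv, huv, rfl⟩
    by_contra! hlt
    have h2 := weightDistribution_add_image C hu
    have h3 := h0 _ (hammingDist_pos.2 huv) hlt
    rw [← h2, weightDistribution, Set.ncard_eq_zero (Set.toFinite _)] at h3
    refine (Set.eq_empty_iff_forall_notMem.1 h3) (u + v) ⟨⟨v, hv, rfl⟩, ?_⟩
    rw [hammingDist_eq_hammingNorm, hneg]

/-- The character `a ↦ i^a` of `ℤ₄`. -/
noncomputable def chi4 : AddChar (ZMod 4) ℂ := AddChar.zmodChar 4 Complex.I_pow_four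

theorem sum_chi4_mul (a : ZMod 4) (w z : ℂ) :
    ∑ b : ZMod 4, chi4 (a * b) * (w ^ (2 - lee b) * z ^ lee b) =
      (w + z) ^ (2 - lee a) * (w - z) ^ lee a := by
  have hI := Complex.I_sq
  have h0 : lee 0 = 0 := by decide
  have h1 : lee 1 = 1 := by decide
  have h2 : lee 2 = 2 := by decide
  have h3 : lee 3 = 1 := by decide
  have c0 : chi4 0 = 1 := AddChar.map_zero_eq_one _
  have c1 : chi4 1 = Complex.I := by
    rw [chi4, AddChar.zmodChar_apply]; exact pow_one _
  have c2 : chi4 2 = -1 := by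
    rw [chi4, AddChar.zmodChar_apply]; exact hI
  have c3 : chi4 3 = -Complex.I := by
    rw [chi4, AddChar.zmodChar_apply]; exact Complex.I_pow_three
  have hs : ∀ f : ZMod 4 → ℂ, ∑ b, f b = f 0 + f 1 + f 2 + f 3 := fun f => by
    rw [show (Finset.univ : Finset (ZMod 4)) = {0, 1, 2, 3} by decide]
    rw [Finset.sum_insert (by decide), Finset.sum_insert (by decide), Finset.sum_insert (by decide),
      Finset.sum_singleton]
    ring
  have ha : a = 0 ∨ a = 1 ∨ a = 2 ∨ a = 3 := by revert a; decide
  rw [hs]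
  rcases ha with rfl | rfl | rfl | rfl
  · simp only [zero_mul, c0, h0, h1, h2, h3]; ring
  · simp only [one_mul, c0, c1, c2, c3, h0, h1, h2, h3]; ring
  · rw [show (2 : ZMod 4) * 0 = 0 by decide, show (2 : ZMod 4) * 1 = 2 by decide,
      show (2 : ZMod 4) * 2 = 0 by decide, show (2 : ZMod 4) * 3 = 2 by decide]
    simp only [c0, c2, h0, h1, h2, h3]; ring
  · rw [show (3 : ZMod 4) * 0 = 0 by decide, show (3 : ZMod 4) * 1 = 3 by decide,
      show (3 : ZMod 4) * 2 = 2 by decide, show (3 : ZMod 4) * 3 = 1 by decide]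
    simp only [c0, c1, c2, c3, h0, h1, h2, h3]; ring

theorem chi4_sum (f : ι → ZMod 4) : chi4 (∑ i, f i) = ∏ i, chi4 (f i) := by
  exact map_prod chi4.toMonoidHom (fun i => Multiplicative.ofAdd (f i)) Finset.univ

variable [DecidableEq ι]

theorem weightEnum_binaryImage (C : Code4 ι) (w z : ℂ) :
    weightEnum (binaryImage C) w z =
      ∑ c, (C : Set (ι → ZMod 4)).indicator
        (fun c => ∏ i, w ^ (2 - lee (c i)) * z ^ lee (c i)) c := by
  classical
  have hterm : ∀ c : ι → ZMod 4, w ^ (Fintype.card (ι ⊕ ι) - hammingNorm (gray c)) *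
      z ^ hammingNorm (gray c) = ∏ i, w ^ (2 - lee (c i)) * z ^ lee (c i) := by
    intro c
    rw [Finset.prod_mul_distrib, Finset.prod_pow_eq_pow_sum, Finset.prod_pow_eq_pow_sum,
      hammingNorm_gray, Finset.sum_tsub_distrib _ fun i _ => lee_le (c i)]
    simp [mul_two]
  have himg : (binaryImage C).toFinite.toFinset =
      (Finset.univ.filter fun c => c ∈ (C : Set (ι → ZMod 4))).image gray := by
    ext x
    simp [binaryImage]
  rw [weightEnum, himg, Finset.sum_image gray_injective.injOn, Finset.sum_indicator_eq_sum_filter]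
  exact Finset.sum_congr rfl fun c _ => hterm c

/-- Orthogonality: the characters `d ↦ i^(d · c)`, `c ∈ C`, sum to the indicator of the dual. -/
theorem sum_indicator_chi4 (C : Code4 ι) (d : ι → ZMod 4) :
    ∑ c, (C : Set (ι → ZMod 4)).indicator (fun c => chi4 (d ⬝ᵥ c)) c =
      ((C : Set (ι → ZMod 4)).ncard : ℂ) *
        (dual C : Set (ι → ZMod 4)).indicator (fun _ => (1 : ℂ)) d := by
  classical
  by_cases hd : d ∈ dual C
  · have h1 : ∀ c ∈ C, chi4 (d ⬝ᵥ c) = 1 := fun c hc => by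
      rw [hd c hc, AddChar.map_zero_eq_one]
    rw [Set.indicator_of_mem hd, mul_one, Set.ncard_eq_toFinset_card', Finset.card_eq_sum_ones,
      Finset.sum_indicator_eq_sum_filter]
    push_cast
    refine Finset.sum_congr (by ext; simp) fun c hc => h1 c (by simpa using hc)
  · rw [Set.indicator_of_notMem hd, mul_zero]
    have : ∃ b ∈ C, d ⬝ᵥ b ≠ 0 := by
      by_contra! h
      exact hd h
    obtain ⟨b, hb, hdb⟩ := this
    have hne : chi4 (d ⬝ᵥ b) ≠ 1 := by
      have : ∀ a : ZMod 4, a ≠ 0 → chi4 a ≠ 1 := by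
        intro a ha
        have ha' : a = 1 ∨ a = 2 ∨ a = 3 := by revert a; decide
        rcases ha' with rfl | rfl | rfl <;> rw [chi4, AddChar.zmodChar_apply]
        · change Complex.I ^ 1 ≠ 1
          simp [Complex.ext_iff]
        · change Complex.I ^ 2 ≠ 1
          norm_num
        · change Complex.I ^ 3 ≠ 1
          simp [Complex.ext_iff, Complex.I_pow_three]
      exact this _ hdb
    set S := ∑ c, (C : Set (ι → ZMod 4)).indicator (fun c => chi4 (d ⬝ᵥ c)) c with hS
    have h2 : S = chi4 (d ⬝ᵥ b) * S := by
      conv_lhs => rw [hS, ← Equiv.sum_comp (Equiv.addLeft b)]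
      rw [hS, Finset.mul_sum]
      refine Finset.sum_congr rfl fun c _ => ?_
      have : b + c ∈ C ↔ c ∈ C := Submodule.add_mem_iff_right _ hb
      by_cases hc : c ∈ C <;> simp [this, hc, dotProduct_add, AddChar.map_add_eq_mul]
    have h3 : (chi4 (d ⬝ᵥ b) - 1) * S = 0 := by linear_combination -h2
    exact (mul_eq_zero.1 h3).resolve_left (sub_ne_zero.2 hne)

/-- The MacWilliams identity for the Gray images of a quaternary code and its dual. -/
theorem weightEnum_dual (C : Code4 ι) (w z : ℂ) :
    ((binaryImage C).ncard : ℂ) * weightEnum (binaryImage (dual C)) w z =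
      weightEnum (binaryImage C) (w + z) (w - z) := by
  classical
  rw [weightEnum_binaryImage, weightEnum_binaryImage, ncard_binaryImage, Finset.mul_sum]
  have h1 : ∀ c : ι → ZMod 4, ∏ i, (w + z) ^ (2 - lee (c i)) * (w - z) ^ lee (c i) =
      ∑ d : ι → ZMod 4, chi4 (d ⬝ᵥ c) * ∏ i, w ^ (2 - lee (d i)) * z ^ lee (d i) := by
    intro c
    simp_rw [← sum_chi4_mul, Fintype.prod_sum, dotProduct, chi4_sum, Finset.prod_mul_distrib,
      mul_comm (c _)]
  have h2 : ∀ c : ι → ZMod 4, (C : Set (ι → ZMod 4)).indicator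
      (fun c => ∏ i, (w + z) ^ (2 - lee (c i)) * (w - z) ^ lee (c i)) c =
      ∑ d : ι → ZMod 4, (C : Set (ι → ZMod 4)).indicator (fun c => chi4 (d ⬝ᵥ c)) c *
        ∏ i, w ^ (2 - lee (d i)) * z ^ lee (d i) := by
    intro c
    by_cases hc : c ∈ C
    · simp only [SetLike.mem_coe, hc, Set.indicator_of_mem, h1]
    · simp [hc]
  simp_rw [h2]
  rw [Finset.sum_comm]
  refine Finset.sum_congr rfl fun d _ => ?_
  rw [← Finset.sum_mul, sum_indicator_chi4]
  by_cases hd : d ∈ dual C <;> simp [hd]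

end Gray

/-! ### Cyclic codes over `ℤ₄` and their check polynomials -/

instance nontrivial_zmod_four : Nontrivial (ZMod 4) := ⟨0, 1, by decide⟩

section Cyclic

variable {n : ℕ}

/-- The polynomial `∑ vᵣ X^r` of a word `v`. -/
noncomputable def wordPoly (v : Fin n → ZMod 4) : (ZMod 4)[X] := ∑ r, C (v r) * X ^ (r : ℕ)

theorem toCyclicRing_eq_mk (v : Fin n → ZMod 4) :
    toCyclicRing n v = AdjoinRoot.mk _ (wordPoly v) := by
  simp [toCyclicRing, wordPoly, Algebra.smul_def, AdjoinRoot.algebraMap_eq]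

theorem mem_cyclicCode_iff_mk_dvd {f : (ZMod 4)[X]} {v : Fin n → ZMod 4} :
    v ∈ cyclicCode n f ↔ AdjoinRoot.mk (X ^ n - 1) f ∣ toCyclicRing n v := by
  simp [cyclicCode, Ideal.mem_span_singleton]

theorem mem_cyclicCode_iff_dvd {f : (ZMod 4)[X]} (hf : f ∣ X ^ n - 1) {v : Fin n → ZMod 4} :
    v ∈ cyclicCode n f ↔ f ∣ wordPoly v := by
  rw [mem_cyclicCode_iff_mk_dvd, toCyclicRing_eq_mk]
  constructor
  · rintro ⟨u, hu⟩
    obtain ⟨k, rfl⟩ := AdjoinRoot.mk_surjective u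
    rw [← map_mul, AdjoinRoot.mk_eq_mk] at hu
    exact (dvd_iff_dvd_of_dvd_sub (hf.trans hu)).2 (dvd_mul_right f k)
  · exact map_dvd _

theorem monic_X_pow_sub_one (hn : n ≠ 0) : (X ^ n - 1 : (ZMod 4)[X]).Monic := by
  simpa using monic_X_pow_sub_C (1 : ZMod 4) hn

theorem root_pow_eq_one : AdjoinRoot.root (X ^ n - 1 : (ZMod 4)[X]) ^ n = 1 := by
  have h := AdjoinRoot.mk_self (f := (X ^ n - 1 : (ZMod 4)[X]))
  rwa [map_sub, map_pow, map_one, AdjoinRoot.mk_X, sub_eq_zero] at h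

/-- The coefficient of `X^0` in `ℤ₄[X] / (X^n - 1)`. -/
noncomputable def constCoeff (hn : n ≠ 0) :
    AdjoinRoot (X ^ n - 1 : (ZMod 4)[X]) →ₗ[ZMod 4] ZMod 4 :=
  (lcoeff (ZMod 4) 0).comp (AdjoinRoot.modByMonicHom (monic_X_pow_sub_one hn))

theorem constCoeff_root_pow (hn : n ≠ 0) (k : ℕ) :
    constCoeff hn (AdjoinRoot.root _ ^ k) = if n ∣ k then 1 else 0 := by
  have hk : AdjoinRoot.root (X ^ n - 1 : (ZMod 4)[X]) ^ k = AdjoinRoot.mk _ (X ^ (k % n)) := by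
    rw [map_pow, AdjoinRoot.mk_X]
    conv_lhs => rw [← Nat.div_add_mod k n, pow_add, pow_mul, root_pow_eq_one, one_pow, one_mul]
  have hdeg : (X ^ (k % n) : (ZMod 4)[X]).degree < (X ^ n - 1 : (ZMod 4)[X]).degree := by
    have h1 : (X ^ n - 1 : (ZMod 4)[X]).degree = n := by
      simpa using degree_X_pow_sub_C (Nat.pos_of_ne_zero hn) (1 : ZMod 4)
    rw [h1, degree_X_pow]
    exact_mod_cast Nat.mod_lt _ (Nat.pos_of_ne_zero hn)
  rw [hk, constCoeff, LinearMap.comp_apply, AdjoinRoot.modByMonicHom_mk,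
    (modByMonic_eq_self_iff (monic_X_pow_sub_one hn)).2 hdeg, lcoeff_apply, coeff_X_pow]
  simp [Nat.dvd_iff_mod_eq_zero, eq_comm]

/-- For a word `c` of length `n`, the functional on `ℤ₄[X]` that sends `X^k` to `c_(k mod n)`. It
is written as the constant coefficient of `c(X) f(X⁻¹)` in `ℤ₄[X] / (X^n - 1)`. -/
noncomputable def wordFunctional (hn : n ≠ 0) (c : Fin n → ZMod 4) :
    (ZMod 4)[X] →ₗ[ZMod 4] ZMod 4 :=
  (constCoeff hn).comp ((LinearMap.mulLeft (ZMod 4) (toCyclicRing n c)).comp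
    (aeval (AdjoinRoot.root (X ^ n - 1 : (ZMod 4)[X]) ^ (n - 1))).toLinearMap)

theorem wordFunctional_apply (hn : n ≠ 0) (c : Fin n → ZMod 4) (f : (ZMod 4)[X]) :
    wordFunctional hn c f = constCoeff hn (toCyclicRing n c *
      aeval (AdjoinRoot.root (X ^ n - 1 : (ZMod 4)[X]) ^ (n - 1)) f) := rfl

theorem wordFunctional_X_pow (hn : n ≠ 0) (c : Fin n → ZMod 4) (k : ℕ) :
    wordFunctional hn c (X ^ k) = c ⟨k % n, Nat.mod_lt _ (Nat.pos_of_ne_zero hn)⟩ := by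
  rw [wordFunctional_apply, map_pow, aeval_X, ← pow_mul]
  have h0 : toCyclicRing n c = ∑ r : Fin n, c r • AdjoinRoot.root _ ^ (r : ℕ) := rfl
  rw [h0, Finset.sum_mul, map_sum,
    Finset.sum_eq_single ⟨k % n, Nat.mod_lt _ (Nat.pos_of_ne_zero hn)⟩]
  · rw [smul_mul_assoc, ← pow_add, map_smul, constCoeff_root_pow, if_pos, smul_eq_mul, mul_one]
    obtain ⟨n, rfl⟩ := Nat.exists_eq_succ_of_ne_zero hn
    refine (Nat.modEq_zero_iff_dvd).1 ?_
    have : k % (n + 1) + n * k ≡ k + n * k [MOD n + 1] := (Nat.mod_modEq k (n + 1)).add_right _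
    exact this.trans ((Nat.modEq_zero_iff_dvd).2 ⟨k, by ring⟩)
  · intro r _ hr
    rw [smul_mul_assoc, ← pow_add, map_smul, constCoeff_root_pow, if_neg, smul_zero]
    intro hd
    apply hr
    obtain ⟨n, rfl⟩ := Nat.exists_eq_succ_of_ne_zero hn
    have h1 : (r : ℕ) + n * k + k ≡ 0 + k [MOD n + 1] :=
      ((Nat.modEq_zero_iff_dvd).2 hd).add_right k
    have h2 : (r : ℕ) + n * k + k ≡ r + 0 [MOD n + 1] := by
      rw [add_assoc]
      exact Nat.ModEq.add_left _ ((Nat.modEq_zero_iff_dvd).2 ⟨k, by ring⟩)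
    have h3 : (r : ℕ) ≡ k [MOD n + 1] := by simpa using h2.symm.trans h1
    ext
    simpa [Nat.ModEq, Nat.mod_eq_of_lt r.2] using h3
  · simp

theorem toCyclicRing_surjective (hn : n ≠ 0) : Function.Surjective (toCyclicRing n) := by
  intro a
  obtain ⟨f, rfl⟩ := AdjoinRoot.mk_surjective a
  refine ⟨fun r => (f %ₘ (X ^ n - 1)).coeff r, ?_⟩
  have hP := monic_X_pow_sub_one hn
  have hdeg : (f %ₘ (X ^ n - 1)).natDegree < n := by
    have h1 : (X ^ n - 1 : (ZMod 4)[X]).natDegree = n := by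
      simpa using natDegree_X_pow_sub_C (n := n) (r := (1 : ZMod 4))
    have := natDegree_modByMonic_lt f hP (by
      intro h
      rw [h, natDegree_one] at h1
      exact hn h1.symm)
    rwa [h1] at this
  rw [toCyclicRing_eq_mk, AdjoinRoot.mk_eq_mk]
  have h2 : wordPoly (fun r : Fin n => (f %ₘ (X ^ n - 1)).coeff r) = f %ₘ (X ^ n - 1) := by
    rw [wordPoly, Fin.sum_univ_eq_sum_range (fun r => C ((f %ₘ (X ^ n - 1)).coeff r) * X ^ r) n]
    exact (as_sum_range_C_mul_X_pow' _ hdeg).symm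
  rw [h2]
  refine ⟨-(f /ₘ (X ^ n - 1)), ?_⟩
  linear_combination modByMonic_add_div f (X ^ n - 1)

/-- The constant coefficient is a nondegenerate functional on the Frobenius algebra
`ℤ₄[X] / (X^n - 1)`. -/
theorem eq_zero_of_constCoeff (hn : n ≠ 0) {a : AdjoinRoot (X ^ n - 1 : (ZMod 4)[X])}
    (ha : ∀ k, constCoeff hn (a * (AdjoinRoot.root _ ^ (n - 1)) ^ k) = 0) : a = 0 := by
  obtain ⟨c, rfl⟩ := toCyclicRing_surjective hn a
  have : c = 0 := by
    funext i
    have := wordFunctional_X_pow hn c i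
    rw [wordFunctional_apply, map_pow, aeval_X, ha] at this
    simp only [Nat.mod_eq_of_lt i.2] at this
    exact this.symm
  rw [this, map_zero]

/-- If `p q = X^n - 1`, then the cyclic code generated by the reciprocal polynomial of `q` consists
of the linear recurring sequences with characteristic polynomial `p`. -/
theorem mem_cyclicCode_reverse_iff (hn : n ≠ 0) {p q : (ZMod 4)[X]} (hp : p.Monic) (hq : q.Monic)
    (hpq : p * q = X ^ n - 1) {c : Fin n → ZMod 4} :
    c ∈ cyclicCode n q.reverse ↔ ∀ f, wordFunctional hn c (p * f) = 0 := by
  have hn1 : n - 1 + 1 = n := Nat.succ_pred_eq_of_ne_zero hn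
  set x := AdjoinRoot.root (X ^ n - 1 : (ZMod 4)[X]) with hx
  set y := x ^ (n - 1) with hy
  have hxy : x * y = 1 := by rw [hy, ← pow_succ', hn1, root_pow_eq_one]
  have hrev : p.reverse * q.reverse = 1 - X ^ n := by
    rw [← reverse_mul (by rw [hp, hq]; decide), hpq]
    have h1 : (X ^ n - 1 : (ZMod 4)[X]).natDegree = n := by
      simpa using natDegree_X_pow_sub_C (n := n) (r := (1 : ZMod 4))
    rw [reverse, h1, reflect_sub, reflect_one, reflect_monomial]
    simp
  -- `p(X⁻¹) = X^(-deg p) · p.reverse`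
  have hpy : aeval y p = AdjoinRoot.mk (X ^ n - 1) p.reverse * y ^ p.natDegree := by
    let _ : Invertible y := ⟨x, hxy, by rw [mul_comm]; exact hxy⟩
    have := eval₂_reverse_mul_pow (algebraMap (ZMod 4) (AdjoinRoot (X ^ n - 1 : (ZMod 4)[X]))) y p
    rw [show (⅟y : AdjoinRoot (X ^ n - 1 : (ZMod 4)[X])) = x from rfl] at this
    rw [aeval_def, ← this, ← aeval_def, hx, AdjoinRoot.aeval_eq]
  have hmk : AdjoinRoot.mk (X ^ n - 1 : (ZMod 4)[X]) p.reverse *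
      AdjoinRoot.mk (X ^ n - 1) q.reverse = 0 := by
    rw [← map_mul, hrev, AdjoinRoot.mk_eq_zero]
    exact ⟨-1, by ring⟩
  rw [mem_cyclicCode_iff_mk_dvd]
  constructor
  · rintro ⟨u, hu⟩ f
    rw [wordFunctional_apply, map_mul (aeval _), hu, hpy,
      show AdjoinRoot.mk (X ^ n - 1) q.reverse * u *
        (AdjoinRoot.mk (X ^ n - 1) p.reverse * y ^ p.natDegree * aeval y f) =
        (AdjoinRoot.mk (X ^ n - 1) p.reverse * AdjoinRoot.mk (X ^ n - 1) q.reverse) *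
          (u * y ^ p.natDegree * aeval y f) by ring, hmk, zero_mul, map_zero]
  · intro h
    have h0 : toCyclicRing n c * aeval y p = 0 := by
      refine eq_zero_of_constCoeff hn fun k => ?_
      have := h (X ^ k)
      rwa [wordFunctional_apply, map_mul (aeval _), map_pow, aeval_X, ← mul_assoc] at this
    have h1 : toCyclicRing n c * AdjoinRoot.mk (X ^ n - 1) p.reverse = 0 := by
      have h2 : y ^ p.natDegree * x ^ p.natDegree = 1 := by
        rw [← mul_pow, mul_comm, hxy, one_pow]
      rw [hpy] at h0
      calc _ = toCyclicRing n c * (AdjoinRoot.mk (X ^ n - 1) p.reverse * y ^ p.natDegree) *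
          x ^ p.natDegree := by
            rw [← mul_assoc, mul_assoc _ (y ^ _), h2, mul_one]
        _ = 0 := by rw [h0, zero_mul]
    rw [toCyclicRing_eq_mk, ← map_mul, AdjoinRoot.mk_eq_zero] at h1
    obtain ⟨k, hk⟩ := h1
    rw [toCyclicRing_eq_mk]
    refine map_dvd _ ⟨-k, ?_⟩
    -- the reciprocal of `p` divides a monic polynomial, so it may be cancelled
    have hreg : ∀ f : (ZMod 4)[X], f * p.reverse = 0 → f = 0 := by
      intro f hf
      have : (X ^ n - 1) * f = 0 := by linear_combination (-q.reverse) * hf + f * hrev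
      exact ((monic_X_pow_sub_one hn).mul_right_eq_zero_iff).1 this
    refine sub_eq_zero.1 (hreg _ ?_)
    linear_combination hk + k * hrev

end Cyclic

/-! ### The Kerdock and 'Preparata' codes in terms of linear functionals -/

section Functional

variable {ι R : Type*} [CommRing R] [Algebra (ZMod 4) R]

/-- The word `j ↦ ε + λ(tⱼ)`, for a constant `ε` and a linear functional `λ`. -/
def affineWord (t : ι → R) : (ZMod 4 × Module.Dual (ZMod 4) R) →ₗ[ZMod 4] (ι → ZMod 4) where
  toFun a j := a.1 + a.2 (t j)
  map_add' a b := by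
    funext j
    simp only [Prod.fst_add, Prod.snd_add, LinearMap.add_apply, Pi.add_apply]
    ring
  map_smul' r a := by
    funext j
    simp [mul_add]

theorem affineWord_apply (t : ι → R) (a : ZMod 4 × Module.Dual (ZMod 4) R) (j : ι) :
    affineWord t a j = a.1 + a.2 (t j) := rfl

/-- The code of all words `j ↦ ε + λ(tⱼ)`. For `t` the enumeration of the Teichmüller set of a
Galois ring this is the quaternary Kerdock code. -/
def affineCode (t : ι → R) : Code4 ι := LinearMap.range (affineWord t)

theorem mem_dual_affineCode_iff [Fintype ι] [Module.Free (ZMod 4) R]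
    (t : ι → R) (d : ι → ZMod 4) :
    d ∈ dual (affineCode t) ↔ ∑ j, d j = 0 ∧ ∑ j, d j • t j = 0 := by
  have key : ∀ a, d ⬝ᵥ affineWord t a = a.1 * ∑ j, d j + a.2 (∑ j, d j • t j) := by
    intro a
    simp only [dotProduct, affineWord_apply, mul_add, Finset.sum_add_distrib, map_sum, map_smul,
      smul_eq_mul, Finset.mul_sum, mul_comm (d _) a.1]
  have hmem : d ∈ dual (affineCode t) ↔ ∀ a, d ⬝ᵥ affineWord t a = 0 :=
    ⟨fun h a => h _ ⟨a, rfl⟩, by rintro h _ ⟨a, rfl⟩; exact h a⟩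
  rw [hmem]
  constructor
  · intro h
    have h1 : ∑ j, d j = 0 := by
      have := h (1, 0)
      rw [key] at this
      simpa using this
    refine ⟨h1, (Module.forall_dual_apply_eq_zero_iff (ZMod 4) _).1 fun f => ?_⟩
    have := h (0, f)
    rw [key] at this
    simpa using this
  · rintro ⟨h1, h2⟩ a
    rw [key, h1, h2, mul_zero, map_zero, add_zero]

end Functional

/-- The Teichmüller set `{0} ∪ {ξ^i}` of `ℤ₄[ξ] = ℤ₄[X] / (h)`; `0` stands at the coordinate `∞`. -/
noncomputable def teichmuller (m : ℕ) (h : (ZMod 4)[X]) (j : Option (Fin (2 ^ m - 1))) :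
    AdjoinRoot h := j.elim 0 fun i => AdjoinRoot.root h ^ (i : ℕ)

theorem mem_preparata_iff {m : ℕ} {h : (ZMod 4)[X]} (hh : IsPrimitiveBasicIrreducible m h)
    (d : Option (Fin (2 ^ m - 1)) → ZMod 4) :
    d ∈ preparata m h ↔ ∑ j, d j = 0 ∧ ∑ j, d j • teichmuller m h j = 0 := by
  have hc : ∀ c : Fin (2 ^ m - 1) → ZMod 4, c ∈ cyclicCode (2 ^ m - 1) h ↔
      ∑ i, c i • AdjoinRoot.root h ^ (i : ℕ) = 0 := by
    intro c
    rw [mem_cyclicCode_iff_dvd hh.dvd, ← AdjoinRoot.mk_eq_zero]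
    simp [wordPoly, Algebra.smul_def, AdjoinRoot.algebraMap_eq]
  have hs : ∑ j, d j • teichmuller m h j =
      ∑ i : Fin (2 ^ m - 1), d (some i) • AdjoinRoot.root h ^ (i : ℕ) := by
    simp [Fintype.sum_option, teichmuller]
  rw [hs, Fintype.sum_option, preparata, extendedCode, Submodule.mem_map]
  constructor
  · rintro ⟨c, hcm, rfl⟩
    exact ⟨neg_add_cancel _, (hc c).1 hcm⟩
  · rintro ⟨h1, h2⟩
    refine ⟨fun i => d (some i), (hc _).2 h2, ?_⟩
    funext j
    rcases j with _ | i
    · exact (eq_neg_of_add_eq_zero_left h1).symm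
    · rfl

namespace IsPrimitiveBasicIrreducible

variable {m : ℕ} {h : (ZMod 4)[X]}

theorem root_pow_eq_one (hh : IsPrimitiveBasicIrreducible m h) :
    AdjoinRoot.root h ^ (2 ^ m - 1) = 1 := by
  obtain ⟨k, hk⟩ := hh.dvd
  have := congrArg (AdjoinRoot.mk h) hk
  rwa [map_mul, AdjoinRoot.mk_self, zero_mul, map_sub, map_pow, map_one, AdjoinRoot.mk_X,
    sub_eq_zero] at this

theorem isUnit_eval_one (hh : IsPrimitiveBasicIrreducible m h) (hm : 2 ≤ m) :
    IsUnit (h.eval 1) := by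
  have key : ∀ a : ZMod 4, ZMod.castHom (by decide : 2 ∣ 4) (ZMod 2) a ≠ 0 → a * a = 1 := by decide
  refine IsUnit.of_mul_eq_one _ (key _ fun h0 => ?_)
  obtain ⟨hdeg, hirr, -⟩ := hh.reduction
  have hroot : (h.map (ZMod.castHom (by decide : 2 ∣ 4) (ZMod 2))).IsRoot 1 := by
    rw [IsRoot, ← map_one (ZMod.castHom (by decide : 2 ∣ 4) (ZMod 2)), eval_map_apply, h0]
  have h1 : natDegree _ = 1 :=
    natDegree_eq_of_degree_eq_some (degree_eq_one_of_irreducible_of_root hirr hroot)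
  omega

theorem X_sub_one_mul_dvd (hh : IsPrimitiveBasicIrreducible m h) (hm : 2 ≤ m) :
    (X - 1) * h ∣ X ^ (2 ^ m - 1) - 1 := by
  refine IsCoprime.mul_dvd ?_
    (by simpa using sub_dvd_pow_sub_pow (X : (ZMod 4)[X]) 1 (2 ^ m - 1)) hh.dvd
  obtain ⟨u, hu⟩ := hh.isUnit_eval_one hm
  obtain ⟨k, hk⟩ : (X - 1 : (ZMod 4)[X]) ∣ h - C (h.eval 1) := by
    simpa using X_sub_C_dvd_sub_C_eval (a := (1 : ZMod 4)) (p := h)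
  refine ⟨-(C ((u⁻¹ : (ZMod 4)ˣ) : ZMod 4)) * k, C ((u⁻¹ : (ZMod 4)ˣ) : ZMod 4), ?_⟩
  have hc : C ((u⁻¹ : (ZMod 4)ˣ) : ZMod 4) * C (h.eval 1) = 1 := by
    rw [← C_mul, ← hu, Units.inv_mul, C_1]
  linear_combination (C ((u⁻¹ : (ZMod 4)ˣ) : ZMod 4)) * hk + hc

end IsPrimitiveBasicIrreducible

/-- The quaternary Kerdock code consists of the words `j ↦ ε + λ(tⱼ)`. -/
theorem kerdock_eq_affineCode {m : ℕ} (hm : 2 ≤ m) {h : (ZMod 4)[X]}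
    (hh : IsPrimitiveBasicIrreducible m h) :
    kerdock m h = affineCode (teichmuller m h) := by
  set n := 2 ^ m - 1 with hndef
  have hN : 4 ≤ 2 ^ m := by
    calc 4 = 2 ^ 2 := by norm_num
      _ ≤ 2 ^ m := Nat.pow_le_pow_right (by norm_num) hm
  have hn : n ≠ 0 := by omega
  have hp : ((X - 1) * h : (ZMod 4)[X]).Monic := by
    have : (X - 1 : (ZMod 4)[X]).Monic := by simpa using monic_X_sub_C (1 : ZMod 4)
    exact this.mul hh.monic
  have hpq : ((X - 1) * h) * ((X ^ n - 1) /ₘ ((X - 1) * h)) = X ^ n - 1 := by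
    have h1 := modByMonic_add_div (X ^ n - 1) ((X - 1) * h)
    rwa [(modByMonic_eq_zero_iff_dvd hp).2 (hh.X_sub_one_mul_dvd hm), zero_add] at h1
  have hq : ((X ^ n - 1) /ₘ ((X - 1) * h)).Monic :=
    hp.of_mul_monic_left (by rw [hpq]; exact monic_X_pow_sub_one hn)
  have hroot : AdjoinRoot.root h ^ n = 1 := hh.root_pow_eq_one
  -- the powers of `ξ` sum to `0`, so that the check symbol of `i ↦ ε + λ(ξ^i)` is `-n ε = ε`
  have hsum : ∑ i : Fin n, AdjoinRoot.root h ^ (i : ℕ) = 0 := by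
    rw [Fin.sum_univ_eq_sum_range (fun i => AdjoinRoot.root h ^ i) n]
    obtain ⟨u, hu⟩ := hh.isUnit_eval_one hm
    obtain ⟨k, hk⟩ := hh.X_sub_one_mul_dvd hm
    have hX : (X - 1 : (ZMod 4)[X]).Monic := by simpa using monic_X_sub_C (1 : ZMod 4)
    have hg : (X - 1) * (∑ i ∈ Finset.range n, X ^ i) = (X - 1 : (ZMod 4)[X]) * (h * k) := by
      rw [mul_geom_sum, hk, mul_assoc]
    have := congrArg (AdjoinRoot.mk h) (hX.isRegular.left hg)
    simpa using this
  have hncast : ((n : ℕ) : ZMod 4) = -1 := by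
    have h4 : ((2 ^ m : ℕ) : ZMod 4) = 0 := by
      rw [ZMod.natCast_eq_zero_iff]
      exact pow_dvd_pow 2 hm
    have h1 : n + 1 = 2 ^ m := by omega
    rw [← h1] at h4
    push_cast at h4
    linear_combination h4
  have key : ∀ c : Fin n → ZMod 4, c ∈ cyclicCode n (kerdockGenerator m h) ↔
      ∃ a : ZMod 4 × Module.Dual (ZMod 4) (AdjoinRoot h),
        ∀ i : Fin n, c i = a.1 + a.2 (AdjoinRoot.root h ^ (i : ℕ)) := by
    intro c
    rw [kerdockGenerator, mem_cyclicCode_reverse_iff hn hp hq hpq]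
    constructor
    · intro hc
      obtain ⟨u, hu⟩ := hh.isUnit_eval_one hm
      set W := wordFunctional hn c with hW
      set ε : ZMod 4 := W h * ((u⁻¹ : (ZMod 4)ˣ) : ZMod 4) with hε
      let L : (ZMod 4)[X] →ₗ[ZMod 4] ZMod 4 := W - ε • leval 1
      have hL : ∀ f, L f = W f - ε * f.eval 1 := fun f => rfl
      have hLh : ∀ k, L (h * k) = 0 := by
        intro k
        obtain ⟨k', hk'⟩ : (X - 1 : (ZMod 4)[X]) ∣ k - C (k.eval 1) := by
          simpa using X_sub_C_dvd_sub_C_eval (a := (1 : ZMod 4)) (p := k)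
        have h1 : h * k = k.eval 1 • h + (X - 1) * h * k' := by
          rw [smul_eq_C_mul]
          linear_combination h * hk'
        have h2 : W (h * k) = k.eval 1 * W h := by
          rw [h1, map_add, hc, add_zero, map_smul, smul_eq_mul]
        have h3 : ((u⁻¹ : (ZMod 4)ˣ) : ZMod 4) * h.eval 1 = 1 := by rw [← hu, Units.inv_mul]
        rw [hL, h2, eval_mul, hε]
        linear_combination (-(W h) * k.eval 1) * h3
      refine ⟨(ε, L.comp (AdjoinRoot.modByMonicHom hh.monic)), fun i => ?_⟩
      have h4 : (L.comp (AdjoinRoot.modByMonicHom hh.monic)) (AdjoinRoot.root h ^ (i : ℕ)) =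
          L (X ^ (i : ℕ)) := by
        have h5 := modByMonic_add_div (X ^ (i : ℕ)) h
        rw [← AdjoinRoot.mk_X, ← map_pow, LinearMap.comp_apply, AdjoinRoot.modByMonicHom_mk]
        conv_rhs => rw [← h5, map_add, hLh, add_zero]
      have h6 : W (X ^ (i : ℕ)) = c i := by
        rw [hW, wordFunctional_X_pow]
        congr 1
        exact Fin.ext (Nat.mod_eq_of_lt i.2)
      change c i = ε + (L.comp (AdjoinRoot.modByMonicHom hh.monic)) (AdjoinRoot.root h ^ (i : ℕ))
      rw [h4, hL, h6, eval_pow, eval_X, one_pow]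
      ring
    · rintro ⟨⟨ε, l⟩, hc⟩ f
      have hW : ∀ f, wordFunctional hn c f = ε * f.eval 1 + l (AdjoinRoot.mk h f) := by
        intro f
        induction f using Polynomial.induction_on' with
        | add f g hf hg => rw [map_add, hf, hg, eval_add, map_add, map_add]; ring
        | monomial k a =>
          have hk : AdjoinRoot.root h ^ k = AdjoinRoot.root h ^ (k % n) := by
            conv_lhs => rw [← Nat.div_add_mod k n, pow_add, pow_mul, hroot, one_pow, one_mul]
          have hm : AdjoinRoot.mk h (a • X ^ k) = a • AdjoinRoot.root h ^ k := by
            rw [smul_eq_C_mul, map_mul, map_pow, AdjoinRoot.mk_X, AdjoinRoot.mk_C, Algebra.smul_def,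
              AdjoinRoot.algebraMap_eq]
          rw [← C_mul_X_pow_eq_monomial, ← smul_eq_C_mul, map_smul, wordFunctional_X_pow, hc, hm,
            map_smul, hk, eval_smul, eval_pow, eval_X, one_pow]
          simp only [smul_eq_mul]
          ring
      rw [hW, mul_assoc, mul_left_comm, map_mul, AdjoinRoot.mk_self, zero_mul, map_zero]
      simp
  ext d
  rw [kerdock, extendedCode, Submodule.mem_map]
  have hword : ∀ a : ZMod 4 × Module.Dual (ZMod 4) (AdjoinRoot h),
      -∑ i : Fin n, (a.1 + a.2 (AdjoinRoot.root h ^ (i : ℕ))) = a.1 := by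
    intro a
    rw [Finset.sum_add_distrib, ← map_sum, hsum, map_zero, add_zero, Finset.sum_const,
      Finset.card_univ, Fintype.card_fin, nsmul_eq_mul, hncast]
    ring
  constructor
  · rintro ⟨c, hc, rfl⟩
    obtain ⟨a, ha⟩ := (key c).1 hc
    refine ⟨a, ?_⟩
    funext j
    rcases j with _ | i
    · change a.1 + a.2 0 = -∑ i, c i
      rw [Finset.sum_congr rfl fun i _ => ha i, hword, map_zero, add_zero]
    · exact (ha i).symm
  · rintro ⟨a, rfl⟩
    refine ⟨fun i => affineWord (teichmuller m h) a (some i), (key _).2 ⟨a, fun i => rfl⟩, ?_⟩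
    funext j
    rcases j with _ | i
    · change -∑ i : Fin n, (a.1 + a.2 (AdjoinRoot.root h ^ (i : ℕ))) = a.1 + a.2 0
      rw [hword, map_zero, add_zero]
    · rfl

theorem preparata_eq_dual_kerdock {m : ℕ} (hm : 2 ≤ m) {h : (ZMod 4)[X]}
    (hh : IsPrimitiveBasicIrreducible m h) : preparata m h = dual (kerdock m h) := by
  have := hh.monic.free_adjoinRoot
  ext d
  rw [kerdock_eq_affineCode hm hh, mem_preparata_iff hh, mem_dual_affineCode_iff]

/-! ### Exponential sums over Teichmüller sets -/

/-- `t` enumerates the Teichmüller set of the Galois ring `R`, with residue map `red : R → F`: it is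
a system of representatives of the residue field that consists of squares. -/
structure IsTeichmuller {ι R F : Type*} [CommRing R] [Field F] (red : R →+* F) (t : ι → R) :
    Prop where
  red_eq_zero_iff : ∀ x, red x = 0 ↔ ∃ y, x = 2 * y
  bijective : Function.Bijective fun j => red (t j)
  isSquare : ∀ j, ∃ s, t j = s ^ 2

theorem four_eq_zero {R : Type*} [CommRing R] [Algebra (ZMod 4) R] : (4 : R) = 0 := by
  rw [← map_ofNat (algebraMap (ZMod 4) R) 4, show (OfNat.ofNat 4 : ZMod 4) = 0 by decide, map_zero]

theorem two_mul_eq_zero_iff {ι' R : Type*} [Fintype ι'] [CommRing R] [Algebra (ZMod 4) R]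
    (b : Module.Basis ι' (ZMod 4) R) (x : R) : 2 * x = 0 ↔ ∃ y, x = 2 * y := by
  have h4 : (4 : R) = 0 := four_eq_zero
  constructor
  · intro h
    have h1 : ∀ a : ZMod 4, 2 * a = 0 → ∃ c, a = 2 * c := by decide
    have h2 : ∀ i, ∃ c, b.repr x i = 2 * c := by
      intro i
      refine h1 _ ?_
      have := congrArg (fun y => b.repr y i) h
      have h3 : (2 * x : R) = (2 : ZMod 4) • x := by rw [Algebra.smul_def, map_ofNat]
      simpa [h3] using this
    choose c hc using h2
    refine ⟨∑ i, c i • b i, ?_⟩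
    conv_lhs => rw [← b.sum_repr x]
    rw [Finset.mul_sum]
    refine Finset.sum_congr rfl fun i _ => ?_
    rw [hc, mul_smul, Algebra.smul_def (2 : ZMod 4), map_ofNat]
  · rintro ⟨y, rfl⟩
    linear_combination y * h4

namespace IsTeichmuller

variable {ι R F : Type*} [CommRing R] [Field F] {red : R →+* F} {t : ι → R}

theorem two_eq_zero (ht : IsTeichmuller red t) : (2 : F) = 0 := by
  have := (ht.red_eq_zero_iff 2).2 ⟨1, (mul_one 2).symm⟩
  rwa [map_ofNat] at this

variable [Algebra (ZMod 4) R]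

/-- A square modulo `4` depends only on the root modulo `2`. -/
theorem sq_eq_sq (ht : IsTeichmuller red t) {x y : R} (h : red x = red y) : x ^ 2 = y ^ 2 := by
  obtain ⟨u, hu⟩ := (ht.red_eq_zero_iff (x - y)).1 (by rw [map_sub, h, sub_self])
  have h4 : (4 : R) = 0 := four_eq_zero
  have hx : x = y + 2 * u := by rw [← hu]; ring
  rw [hx]
  linear_combination (y * u + u ^ 2) * h4

/-- Distinct pairs of Teichmüller elements have distinct differences, zero excepted: writing the
elements as squares, `a² + b² = (a + b)² - 2ab` shows that a sum of two of them determines the sum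
and the product of their residues. -/
theorem sub_injective {ι' : Type*} [Fintype ι'] (ht : IsTeichmuller red t)
    (bs : Module.Basis ι' (ZMod 4) R) {a b c d : ι} (hab : a ≠ b)
    (h : t a - t b = t c - t d) : a = c ∧ b = d := by
  have h2 := ht.two_eq_zero
  have hsq : ∀ x y : F, x ^ 2 = y ^ 2 → x = y := by
    intro x y hxy
    have : (x - y) ^ 2 = 0 := by linear_combination hxy - (x * y - y ^ 2) * h2
    exact sub_eq_zero.1 (pow_eq_zero_iff (two_ne_zero)|>.1 this)
  obtain ⟨sa, ha⟩ := ht.isSquare a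
  obtain ⟨sb, hb⟩ := ht.isSquare b
  obtain ⟨sc, hc⟩ := ht.isSquare c
  obtain ⟨sd, hd⟩ := ht.isSquare d
  have hsum : red (sa + sd) = red (sc + sb) := by
    apply hsq
    have h0 := congrArg red h
    rw [ha, hb, hc, hd] at h0
    simp only [map_sub, map_add, map_pow] at h0 ⊢
    linear_combination h0 + (red sa * red sd - red sc * red sb) * h2
  have hprod : red (sa * sd) = red (sc * sb) := by
    have h3 : 2 * (sa * sd - sc * sb) = 0 := by
      rw [ha, hb, hc, hd] at h
      linear_combination ht.sq_eq_sq hsum - h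
    have := (ht.red_eq_zero_iff _).2 ((two_mul_eq_zero_iff bs _).1 h3)
    rwa [map_sub, sub_eq_zero] at this
  have hor : (red sa - red sc) * (red sa - red sb) = 0 := by
    simp only [map_add, map_mul] at hsum hprod
    linear_combination red sa * hsum - hprod
  rcases mul_eq_zero.1 hor with h3 | h3
  · have h4 : t a = t c := by rw [ha, hc]; exact ht.sq_eq_sq (sub_eq_zero.1 h3)
    have h5 : t b = t d := by linear_combination h4 - h
    exact ⟨ht.bijective.1 (congrArg red h4), ht.bijective.1 (congrArg red h5)⟩
  · have h4 : t a = t b := by rw [ha, hb]; exact ht.sq_eq_sq (sub_eq_zero.1 h3)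
    exact absurd (ht.bijective.1 (congrArg red h4)) hab

theorem exists_eq_zero (ht : IsTeichmuller red t) : ∃ j, t j = 0 := by
  obtain ⟨j, hj⟩ := ht.bijective.2 0
  obtain ⟨s, hs⟩ := ht.isSquare j
  refine ⟨j, ?_⟩
  have h0 : red s = red 0 := by
    have h1 : red s ^ 2 = 0 := by
      rw [← map_pow, ← hs]
      exact hj
    rw [map_zero]
    exact pow_eq_zero_iff two_ne_zero |>.1 h1
  rw [hs, ht.sq_eq_sq h0]
  simp

variable [Fintype ι] [Fintype R] [DecidableEq R] [DecidableEq F]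

/-- The differences of distinct Teichmüller elements run through the units, once each. -/
theorem image_sub_offDiag {m : ℕ} (ht : IsTeichmuller red t)
    (bs : Module.Basis (Fin m) (ZMod 4) R) (hcard : Fintype.card ι = 2 ^ m) :
    (Finset.univ : Finset ι).offDiag.image (fun p => t p.1 - t p.2) =
      Finset.univ.filter fun u => red u ≠ 0 := by
  have hF : Nat.card F = 2 ^ m := by
    rw [← Nat.card_congr (Equiv.ofBijective _ ht.bijective), Nat.card_eq_fintype_card, hcard]
  have hR : Fintype.card R = 2 ^ m * 2 ^ m := by
    rw [Fintype.card_congr bs.equivFun.toEquiv, Fintype.card_fun, ZMod.card, Fintype.card_fin,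
      ← mul_pow]
    norm_num
  have hsurj : Function.Surjective red := fun y => by
    obtain ⟨j, hj⟩ := ht.bijective.2 y
    exact ⟨t j, hj⟩
  have hker : (Finset.univ.filter fun u => red u = 0).card = 2 ^ m := by
    have h1 := AddSubgroup.card_mul_index red.toAddMonoidHom.ker
    rw [AddSubgroup.index_ker, AddMonoidHom.range_eq_top.2 hsurj, AddSubgroup.card_top, hF,
      Nat.card_eq_fintype_card (α := R), hR] at h1
    have h2 := Nat.eq_of_mul_eq_mul_right (by positivity) h1
    rw [← h2, Nat.card_eq_fintype_card, Fintype.card_subtype]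
    exact congrArg Finset.card (by ext u; simp [AddMonoidHom.mem_ker])
  refine Finset.eq_of_subset_of_card_le ?_ ?_
  · intro u hu
    obtain ⟨⟨a, b⟩, hp, rfl⟩ := Finset.mem_image.1 hu
    simp only [Finset.mem_offDiag, Finset.mem_univ, true_and] at hp
    simp only [Finset.mem_filter, Finset.mem_univ, true_and, map_sub]
    exact fun h => hp (ht.bijective.1 (sub_eq_zero.1 h))
  · rw [Finset.card_image_of_injOn, Finset.offDiag_card, Finset.card_univ, hcard]
    · show (Finset.univ.filter fun u => ¬ red u = 0).card ≤ _
      have h1 := Finset.card_filter_add_card_filter_not (s := (Finset.univ : Finset R))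
        (fun u => red u = 0)
      rw [hker, Finset.card_univ, hR] at h1
      omega
    · rintro ⟨a, b⟩ hp ⟨c, d⟩ - h
      simp only [Finset.coe_offDiag, Set.mem_offDiag] at hp
      obtain ⟨rfl, rfl⟩ := ht.sub_injective bs hp.2.2 h
      rfl

end IsTeichmuller

section Sums

theorem re4_sub (a b : ZMod 4) : re4 (a - b) = re4 a * re4 b + im4 a * im4 b := by
  revert a b; decide

theorem re4_add_two (a : ZMod 4) : re4 (a + 2) = -re4 a := by revert a; decide

variable {m : ℕ} {ι R F : Type*} [CommRing R] [Algebra (ZMod 4) R] [Field F] {red : R →+* F}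
  {t : ι → R} [Fintype ι]

/-- A functional that is nonzero modulo `2` takes the value `2` on `2 R`. -/
theorem exists_apply_two_mul_eq_two {l : Module.Dual (ZMod 4) R} (hl : (2 : ZMod 4) • l ≠ 0) :
    ∃ v, l (2 * v) = 2 := by
  by_contra! h
  refine hl (LinearMap.ext fun v => ?_)
  have h1 := h v
  have h2 : (2 * v : R) = (2 : ZMod 4) • v := by rw [Algebra.smul_def, map_ofNat]
  rw [h2, map_smul] at h1
  have : ∀ a : ZMod 4, (2 : ZMod 4) • a ≠ 2 → (2 : ZMod 4) • a = 0 := by decide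
  exact this _ h1

/-- The exponential sum `∑ⱼ i^(λ(tⱼ))` of a functional `λ` that is nonzero modulo `2` has absolute
value `√N`, with `N = 2^m` the size of the Teichmüller set. -/
theorem sum_re4_sq_add_sum_im4_sq (ht : IsTeichmuller red t)
    (bs : Module.Basis (Fin m) (ZMod 4) R) (hcard : Fintype.card ι = 2 ^ m)
    {l : Module.Dual (ZMod 4) R} (hl : (2 : ZMod 4) • l ≠ 0) :
    (∑ j, re4 (l (t j))) ^ 2 + (∑ j, im4 (l (t j))) ^ 2 = 2 ^ m := by
  classical
  let _ : Fintype R := Fintype.ofEquiv _ bs.equivFun.toEquiv.symm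
  have hexp : (∑ j, re4 (l (t j))) ^ 2 + (∑ j, im4 (l (t j))) ^ 2 =
      ∑ p : ι × ι, re4 (l (t p.1 - t p.2)) := by
    rw [pow_two, pow_two, Finset.sum_mul_sum, Finset.sum_mul_sum, ← Finset.sum_add_distrib,
      Fintype.sum_prod_type]
    refine Finset.sum_congr rfl fun a _ => ?_
    rw [← Finset.sum_add_distrib]
    refine Finset.sum_congr rfl fun b _ => ?_
    rw [map_sub, re4_sub]
  obtain ⟨v, hv⟩ := exists_apply_two_mul_eq_two hl
  have hunits : ∑ u with red u ≠ 0, re4 (l u) = 0 := by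
    have h1 : ∑ u with red u ≠ 0, re4 (l u) = ∑ u with red u ≠ 0, -re4 (l u) := by
      refine Finset.sum_equiv (Equiv.addRight (2 * v)) (fun u => ?_) fun u _ => ?_
      · have h2v : red (2 * v) = 0 := (ht.red_eq_zero_iff _).2 ⟨v, rfl⟩
        simp only [Finset.mem_filter, Finset.mem_univ, Equiv.coe_addRight, map_add, h2v, add_zero]
      · rw [Equiv.coe_addRight, map_add, hv, re4_add_two, neg_neg]
    rw [Finset.sum_neg_distrib] at h1
    linarith
  rw [hexp, ← Finset.univ_product_univ, ← Finset.diag_union_offDiag,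
    Finset.sum_union (Finset.disjoint_diag_offDiag _), Finset.sum_diag]
  have hoff : ∑ p ∈ (Finset.univ : Finset ι).offDiag, re4 (l (t p.1 - t p.2)) = 0 := by
    rw [← hunits, ← ht.image_sub_offDiag bs hcard, Finset.sum_image]
    rintro ⟨a, b⟩ hp ⟨c, d⟩ - h
    simp only [Finset.coe_offDiag, Set.mem_offDiag] at hp
    obtain ⟨rfl, rfl⟩ := ht.sub_injective bs hp.2.2 h
    rfl
  rw [hoff]
  simp [re4, hcard]

/-- The nonzero functionals that vanish modulo `2` give balanced words. -/
theorem sum_re4_eq_zero (ht : IsTeichmuller red t)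
    {l : Module.Dual (ZMod 4) R} (hl : (2 : ZMod 4) • l = 0) (hl0 : l ≠ 0) (ε : ZMod 4) :
    ∑ j, re4 (ε + l (t j)) = 0 := by
  have hdouble : ∀ x, l (2 * x) = 0 := by
    intro x
    have h2 : (2 * x : R) = (2 : ZMod 4) • x := by rw [Algebra.smul_def, map_ofNat]
    have := LinearMap.congr_fun hl x
    rwa [LinearMap.smul_apply, ← map_smul, ← h2] at this
  obtain ⟨v, hv⟩ : ∃ v, l v = 2 := by
    by_contra! h
    refine hl0 (LinearMap.ext fun v => ?_)
    have h1 : (2 : ZMod 4) • l v = 0 := LinearMap.congr_fun hl v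
    have : ∀ a : ZMod 4, (2 : ZMod 4) • a = 0 → a ≠ 2 → a = 0 := by decide
    exact this _ h1 (h v)
  let e : ι ≃ F := Equiv.ofBijective _ ht.bijective
  -- `s` permutes the coordinates as the translation by `v` does modulo `2`
  let s : ι ≃ ι := e.trans ((Equiv.addRight (red v)).trans e.symm)
  have hs : ∀ j, l (t (s j)) = l (t j) + 2 := by
    intro j
    have h1 : red (t (s j)) = red (t j) + red v := e.apply_symm_apply (e j + red v)
    obtain ⟨y, hy⟩ := (ht.red_eq_zero_iff (t (s j) - (t j + v))).1 (by
      rw [map_sub, map_add, h1, sub_self])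
    have h2 := hdouble y
    rw [← hy, map_sub, map_add, hv, sub_eq_zero] at h2
    exact h2
  have h1 : ∑ j, re4 (ε + l (t j)) = -∑ j, re4 (ε + l (t j)) := by
    conv_lhs => rw [← Equiv.sum_comp s]
    rw [← Finset.sum_neg_distrib]
    refine Finset.sum_congr rfl fun j _ => ?_
    rw [hs, ← add_assoc, re4_add_two]
  linarith

/-- The only representations of an odd power of `2` as a sum of two squares. -/
theorem sq_eq_of_sq_add_sq_eq {k : ℕ} : ∀ {x y : ℤ}, x ^ 2 + y ^ 2 = 2 ^ (2 * k + 1) →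
    x ^ 2 = (2 ^ k) ^ 2 ∧ y ^ 2 = (2 ^ k) ^ 2 := by
  induction k with
  | zero =>
    intro x y h
    have h2 : x ^ 2 + y ^ 2 = 2 := by simpa using h
    have hx1 : x ≤ 1 := by nlinarith [sq_nonneg y]
    have hx2 : -1 ≤ x := by nlinarith [sq_nonneg y]
    have hy1 : y ≤ 1 := by nlinarith [sq_nonneg x]
    have hy2 : -1 ≤ y := by nlinarith [sq_nonneg x]
    interval_cases x <;> interval_cases y <;> simp_all
  | succ k ih =>
    intro x y h
    have h4 : x ^ 2 + y ^ 2 = 4 * 2 ^ (2 * k + 1) := by rw [h]; ring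
    obtain ⟨x', hx⟩ := Int.even_or_odd' x
    obtain ⟨y', hy⟩ := Int.even_or_odd' y
    obtain rfl | rfl := hx <;> obtain rfl | rfl := hy
    · have h5 : x' ^ 2 + y' ^ 2 = 2 ^ (2 * k + 1) := by linarith
      obtain ⟨h6, h7⟩ := ih h5
      constructor
      · rw [mul_pow, h6]; ring
      · rw [mul_pow, h7]; ring
    all_goals
      exfalso
      ring_nf at h4
      omega

end Sums

section Enumerator

variable {m : ℕ} {ι R F : Type*} [CommRing R] [Algebra (ZMod 4) R] [Field F] {red : R →+* F}
  {t : ι → R} [Fintype ι]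

theorem affineWord_injective (ht : IsTeichmuller red t)
    (bs : Module.Basis (Fin m) (ZMod 4) R) (hcard : Fintype.card ι = 2 ^ m) :
    Function.Injective (affineWord t) := by
  classical
  let _ : Fintype R := Fintype.ofEquiv _ bs.equivFun.toEquiv.symm
  rw [← LinearMap.ker_eq_bot, LinearMap.ker_eq_bot']
  rintro ⟨ε, l⟩ h
  have hj : ∀ j, ε + l (t j) = 0 := fun j => congrFun h j
  obtain ⟨j₀, hj₀⟩ := ht.exists_eq_zero
  have hε : ε = 0 := by simpa [hj₀] using hj j₀
  have hlt : ∀ j, l (t j) = 0 := fun j => by simpa [hε] using hj j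
  have hunit : ∀ u, red u ≠ 0 → l u = 0 := by
    intro u hu
    have hmem : u ∈ Finset.univ.filter fun u => red u ≠ 0 := by simpa using hu
    rw [← ht.image_sub_offDiag bs hcard] at hmem
    obtain ⟨p, -, rfl⟩ := Finset.mem_image.1 hmem
    rw [map_sub, hlt, hlt, sub_zero]
  refine Prod.ext hε (LinearMap.ext fun u => ?_)
  by_cases hu : red u = 0
  · have h1 := hunit (u + 1) (by rw [map_add, hu, map_one, zero_add]; exact one_ne_zero)
    rwa [map_add, hunit 1 (by rw [map_one]; exact one_ne_zero), add_zero] at h1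
  · exact hunit u hu

theorem card_dual (bs : Module.Basis (Fin m) (ZMod 4) R) [Fintype (Module.Dual (ZMod 4) R)] :
    Fintype.card (Module.Dual (ZMod 4) R) = 2 ^ m * 2 ^ m := by
  rw [← Fintype.card_congr (bs.constr (ZMod 4) (M' := ZMod 4)).toEquiv, Fintype.card_fun, ZMod.card,
    Fintype.card_fin, ← mul_pow]
  norm_num

theorem card_dual_two_torsion (bs : Module.Basis (Fin m) (ZMod 4) R)
    [Fintype (Module.Dual (ZMod 4) R)] [DecidableEq (Module.Dual (ZMod 4) R)] :
    (Finset.univ.filter fun l : Module.Dual (ZMod 4) R => (2 : ZMod 4) • l = 0).card = 2 ^ m := by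
  have h1 : (Finset.univ.filter fun l : Module.Dual (ZMod 4) R => (2 : ZMod 4) • l = 0) =
      (Fintype.piFinset fun _ : Fin m => ({0, 2} : Finset (ZMod 4))).map
        (bs.constr (ZMod 4) (M' := ZMod 4)).toEquiv.toEmbedding := by
    ext l
    obtain ⟨f, rfl⟩ := (bs.constr (ZMod 4) (M' := ZMod 4)).surjective l
    rw [Finset.mem_filter, ← map_smul, LinearEquiv.map_eq_zero_iff]
    have h2 : ∀ a : ZMod 4, (2 : ZMod 4) • a = 0 ↔ a = 0 ∨ a = 2 := by decide
    simp only [funext_iff, Pi.smul_apply, Pi.zero_apply, h2]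
    simp
  rw [h1, Finset.card_map, Fintype.card_piFinset]
  simp only [Finset.prod_const, Finset.card_univ, Fintype.card_fin]
  congr 1

theorem lee_word_eq {c : ι → ZMod 4} {s : ℤ} (hs : ∑ j, re4 (c j) = s) :
    ((∑ j, lee (c j) : ℕ) : ℤ) = Fintype.card ι - s := by
  rw [sum_lee_eq, hs]

/-- The sum over the four translates `ε + c` of a word `c`, in terms of the real and the imaginary
part of `∑ⱼ i^(cⱼ)`. -/
theorem sum_re4_add (c : ι → ZMod 4) :
    ∑ j, re4 (0 + c j) = ∑ j, re4 (c j) ∧ ∑ j, re4 (1 + c j) = -∑ j, im4 (c j) ∧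
      ∑ j, re4 (2 + c j) = -∑ j, re4 (c j) ∧ ∑ j, re4 (3 + c j) = ∑ j, im4 (c j) := by
  have h1 : ∀ a, re4 (1 + a) = -im4 a := by decide
  have h2 : ∀ a, re4 (2 + a) = -re4 a := by decide
  have h3 : ∀ a, re4 (3 + a) = im4 a := by decide
  simp [h1, h2, h3]

theorem sum_zmod_four {M : Type*} [AddCommMonoid M] (f : ZMod 4 → M) :
    ∑ b, f b = f 0 + (f 1 + (f 2 + f 3)) := by
  rw [show (Finset.univ : Finset (ZMod 4)) = {0, 1, 2, 3} by decide,
    Finset.sum_insert (by decide), Finset.sum_insert (by decide), Finset.sum_insert (by decide),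
    Finset.sum_singleton]

/-- The weight enumerator of the Kerdock code of length `2N`, `N = 2^(2k+1)`. -/
theorem weightEnum_affineCode {k N : ℕ} (ht : IsTeichmuller red t)
    (bs : Module.Basis (Fin m) (ZMod 4) R) (hcard : Fintype.card ι = N) (hN : N = 2 ^ m)
    (hm : m = 2 * k + 1) (w z : ℂ) :
    weightEnum (binaryImage (affineCode t)) w z =
      w ^ (2 * N) + z ^ (2 * N) + (4 * N - 2) * (w ^ N * z ^ N) +
        2 * N * (N - 1) * (w ^ (N + 2 ^ k) * z ^ (N - 2 ^ k) +
          w ^ (N - 2 ^ k) * z ^ (N + 2 ^ k)) := by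
  classical
  let _ : Fintype (Module.Dual (ZMod 4) R) :=
    Fintype.ofEquiv _ (bs.constr (ZMod 4) (M' := ZMod 4)).toEquiv
  have hk : 2 ^ k ≤ N := by
    rw [hN]
    exact Nat.pow_le_pow_right (by norm_num) (by omega)
  -- the term of a word with `∑ⱼ Re i^(cⱼ) = s`
  have hterm : ∀ (c : ι → ZMod 4) (p q : ℕ), ∑ j, re4 (c j) = (p : ℤ) - N → p + q = 2 * N →
      ∏ j, w ^ (2 - lee (c j)) * z ^ lee (c j) = w ^ p * z ^ q := by
    intro c p q hs hpq
    have h1 := lee_word_eq hs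
    rw [hcard] at h1
    have h2 : ∑ j, lee (c j) = q := by omega
    rw [Finset.prod_mul_distrib, Finset.prod_pow_eq_pow_sum, Finset.prod_pow_eq_pow_sum,
      Finset.sum_tsub_distrib _ fun i _ => lee_le (c i), h2]
    congr 2
    simp only [Finset.sum_const, Finset.card_univ, hcard, smul_eq_mul]
    omega
  set T : Module.Dual (ZMod 4) R → ZMod 4 → ℂ := fun l ε =>
    ∏ j, w ^ (2 - lee (ε + l (t j))) * z ^ lee (ε + l (t j)) with hT
  have hsum : weightEnum (binaryImage (affineCode t)) w z = ∑ l, ∑ ε, T l ε := by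
    rw [weightEnum_binaryImage, Finset.sum_indicator_eq_sum_filter]
    have h1 : (Finset.univ.filter fun c => c ∈ (affineCode t : Set (ι → ZMod 4))) =
        Finset.univ.image (affineWord t) := by
      ext c
      simp [affineCode]
    rw [h1, Finset.sum_image (affineWord_injective ht bs (hcard.trans hN)).injOn,
      Fintype.sum_prod_type_right]
    rfl
  have h0 : ∑ ε, T 0 ε = w ^ (2 * N) + z ^ (2 * N) + 2 * (w ^ N * z ^ N) := by
    have hc : ∀ ε : ZMod 4, ∑ j : ι, re4 (ε + (0 : Module.Dual (ZMod 4) R) (t j)) = N * re4 ε := by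
      intro ε
      simp [hcard]
    have r0 : re4 0 = 1 := by decide
    have r1 : re4 1 = 0 := by decide
    have r2 : re4 2 = -1 := by decide
    have r3 : re4 3 = 0 := by decide
    rw [sum_zmod_four,
      show T 0 0 = _ from hterm _ (2 * N) 0 (by rw [hc, r0]; push_cast; ring) (by ring),
      show T 0 1 = _ from hterm _ N N (by rw [hc, r1]; ring) (by ring),
      show T 0 2 = _ from hterm _ 0 (2 * N) (by rw [hc, r2]; push_cast; ring) (by ring),
      show T 0 3 = _ from hterm _ N N (by rw [hc, r3]; ring) (by ring)]
    ring
  have h1 : ∀ l, (2 : ZMod 4) • l = 0 → l ≠ 0 → ∑ ε, T l ε = 4 * (w ^ N * z ^ N) := by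
    intro l hl hl0
    rw [Finset.sum_congr rfl fun ε _ =>
      show T l ε = w ^ N * z ^ N from
        hterm _ N N (by rw [sum_re4_eq_zero ht hl hl0, sub_self]) (by ring)]
    simp
  have h2 : ∀ l, (2 : ZMod 4) • l ≠ 0 → ∑ ε, T l ε =
      2 * (w ^ (N + 2 ^ k) * z ^ (N - 2 ^ k) + w ^ (N - 2 ^ k) * z ^ (N + 2 ^ k)) := by
    intro l hl
    have hsq := sum_re4_sq_add_sum_im4_sq ht bs (hcard.trans hN) hl
    rw [hm] at hsq
    obtain ⟨hx, hy⟩ := sq_eq_of_sq_add_sq_eq hsq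
    obtain ⟨e0, e1, e2, e3⟩ := sum_re4_add fun j => l (t j)
    have plus : ∀ ε, ∑ j, re4 (ε + l (t j)) = 2 ^ k →
        T l ε = w ^ (N + 2 ^ k) * z ^ (N - 2 ^ k) := fun ε h =>
      hterm _ _ _ (by rw [h]; push_cast; ring) (by omega)
    have minus : ∀ ε, ∑ j, re4 (ε + l (t j)) = -2 ^ k →
        T l ε = w ^ (N - 2 ^ k) * z ^ (N + 2 ^ k) := fun ε h =>
      hterm _ _ _ (by rw [h]; push_cast [hk]; ring) (by omega)
    have hre : T l 0 + T l 2 =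
        w ^ (N + 2 ^ k) * z ^ (N - 2 ^ k) + w ^ (N - 2 ^ k) * z ^ (N + 2 ^ k) := by
      rcases sq_eq_sq_iff_eq_or_eq_neg.1 hx with h | h
      · rw [plus 0 (e0.trans h), minus 2 (by rw [e2, h])]
      · rw [minus 0 (e0.trans h), plus 2 (by rw [e2, h, neg_neg]), add_comm]
    have him : T l 1 + T l 3 =
        w ^ (N + 2 ^ k) * z ^ (N - 2 ^ k) + w ^ (N - 2 ^ k) * z ^ (N + 2 ^ k) := by
      rcases sq_eq_sq_iff_eq_or_eq_neg.1 hy with h | h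
      · rw [minus 1 (by rw [e1, h]), plus 3 (e3.trans h), add_comm]
      · rw [plus 1 (by rw [e1, h, neg_neg]), minus 3 (e3.trans h)]
    rw [sum_zmod_four]
    linear_combination hre + him
  have hcard2 := card_dual_two_torsion bs
  have hcard1 := card_dual bs
  have h0mem : (0 : Module.Dual (ZMod 4) R) ∈
      Finset.univ.filter fun l : Module.Dual (ZMod 4) R => (2 : ZMod 4) • l = 0 :=
    Finset.mem_filter.2 ⟨Finset.mem_univ 0, smul_zero _⟩
  rw [hsum, ← Finset.sum_filter_add_sum_filter_not Finset.univ
    (fun l : Module.Dual (ZMod 4) R => (2 : ZMod 4) • l = 0),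
    Finset.sum_congr (s₁ := Finset.univ.filter fun l : Module.Dual (ZMod 4) R => ¬ _) rfl
      (fun l hl => h2 l (Finset.mem_filter.1 hl).2),
    ← Finset.add_sum_erase _ _ h0mem, h0,
    Finset.sum_congr (s₁ := Finset.erase _ _) rfl
      (fun l hl => h1 l (Finset.mem_filter.1 (Finset.mem_erase.1 hl).2).2
        (Finset.mem_erase.1 hl).1),
    Finset.sum_const, Finset.sum_const,
    Finset.card_erase_of_mem h0mem, hcard2]
  have h3 : (Finset.univ.filter fun l : Module.Dual (ZMod 4) R => ¬ (2 : ZMod 4) • l = 0).card =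
      N * N - N := by
    have := Finset.card_filter_add_card_filter_not
      (s := (Finset.univ : Finset (Module.Dual (ZMod 4) R))) (fun l => (2 : ZMod 4) • l = 0)
    rw [hcard2, Finset.card_univ, hcard1, ← hN] at this
    omega
  have hN1 : 1 ≤ N := le_trans Nat.one_le_two_pow hk
  rw [h3, ← hN, nsmul_eq_mul, nsmul_eq_mul, Nat.cast_sub hN1, Nat.cast_sub (Nat.le_mul_self N)]
  push_cast
  ring

/-- The weight enumerator of the dual of the Kerdock code, from the MacWilliams identity. -/
theorem hasPreparataEnumerator_dual_affineCode {k N : ℕ} (ht : IsTeichmuller red t)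
    (bs : Module.Basis (Fin m) (ZMod 4) R) (hcard : Fintype.card ι = N) (hN : N = 2 ^ m)
    (hm : m = 2 * k + 1) :
    HasPreparataEnumerator (binaryImage (dual (affineCode t))) k N := by
  classical
  intro w z
  rw [← weightEnum_affineCode ht bs hcard hN hm, ← weightEnum_dual]
  congr 1
  rw [← weightEnum_one_one, weightEnum_affineCode ht bs hcard hN hm]
  ring

end Enumerator

/-! ### Characters of finite fields of characteristic two -/

/-- The nontrivial character of `ℤ₂`. -/
noncomputable def chi2 : AddChar (ZMod 2) ℂ := AddChar.zmodChar 2 (neg_one_sq (R := ℂ))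

theorem chi2_zero : chi2 0 = 1 := AddChar.map_zero_eq_one _

theorem chi2_one : chi2 1 = -1 := by rw [chi2, AddChar.zmodChar_apply]; exact pow_one _

theorem chi2_sum {ι : Type*} [Fintype ι] (f : ι → ZMod 2) : chi2 (∑ i, f i) = ∏ i, chi2 (f i) :=
  map_prod chi2.toMonoidHom (fun i => Multiplicative.ofAdd (f i)) Finset.univ

theorem eq_zero_or_one (a : ZMod 2) : a = 0 ∨ a = 1 := by revert a; decide

theorem sum_zmod_two {M : Type*} [AddCommMonoid M] (f : ZMod 2 → M) : ∑ b, f b = f 0 + f 1 :=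
  Fin.sum_univ_two f

theorem sum_chi2_mul (a : ZMod 2) : ∑ ε, chi2 (ε * a) = if a = 0 then 2 else 0 := by
  rw [sum_zmod_two]
  rcases eq_zero_or_one a with rfl | rfl
  · norm_num [chi2_zero]
  · norm_num [chi2_zero, chi2_one]

section BinaryWords

variable {κ : Type*} [Fintype κ]

/-- The term of the binary word `b` in a weight enumerator. -/
noncomputable def weightTerm (w z : ℂ) (b : κ → ZMod 2) : ℂ :=
  w ^ (Fintype.card κ - hammingNorm b) * z ^ hammingNorm b

theorem weightTerm_eq_prod (w z : ℂ) (b : κ → ZMod 2) :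
    weightTerm w z b = ∏ x, if b x = 0 then w else z := by
  classical
  have h1 : (Finset.univ.filter fun x => b x = 0).card = Fintype.card κ - hammingNorm b := by
    have := Finset.card_filter_add_card_filter_not (s := (Finset.univ : Finset κ))
      (fun x => b x = 0)
    rw [Finset.card_univ] at this
    rw [hammingNorm]
    simp only [ne_eq]
    omega
  rw [Finset.prod_ite, Finset.prod_const, Finset.prod_const, h1]
  rfl

theorem weightTerm_sumElim (w z : ℂ) (b b' : κ → ZMod 2) :
    weightTerm w z (Sum.elim b b') = weightTerm w z b * weightTerm w z b' := by
  rw [weightTerm_eq_prod, Fintype.prod_sum_type, weightTerm_eq_prod, weightTerm_eq_prod]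
  rfl

/-- The Fourier transform of the weight. -/
theorem sum_weightTerm_mul_chi2 [DecidableEq κ] (w z : ℂ) (u : κ → ZMod 2) :
    ∑ b : κ → ZMod 2, weightTerm w z b * chi2 (∑ x, u x * b x) = weightTerm (w + z) (w - z) u := by
  simp_rw [weightTerm_eq_prod, chi2_sum, ← Finset.prod_mul_distrib]
  have h := Fintype.prod_sum (fun (x : κ) (a : ZMod 2) => (if a = 0 then w else z) * chi2 (u x * a))
  rw [← h]
  refine Finset.prod_congr rfl fun x _ => ?_
  rw [sum_zmod_two]
  rcases eq_zero_or_one (u x) with hu | hu <;> simp [hu, chi2_one, sub_eq_add_neg]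

theorem sum_chi2_eq (u : κ → ZMod 2) :
    ∑ x, chi2 (u x) = Fintype.card κ - 2 * (hammingNorm u : ℂ) := by
  classical
  have h : ∀ a : ZMod 2, chi2 a = 1 - 2 * (if a ≠ 0 then 1 else 0 : ℂ) := by
    intro a
    rcases eq_zero_or_one a with rfl | rfl
    · simp
    · norm_num [chi2_one]
  simp_rw [h]
  rw [Finset.sum_sub_distrib, ← Finset.mul_sum, Finset.sum_boole, hammingNorm]
  simp

/-- The two translates of a word `u`, in terms of its character sum. -/
theorem sum_weightTerm_add {p q : ℕ} (hpq : p + q = Fintype.card κ) (w z : ℂ) (u : κ → ZMod 2)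
    (hu : ∑ x, chi2 (u x) = p - q ∨ ∑ x, chi2 (u x) = q - p) :
    ∑ ε : ZMod 2, weightTerm w z (fun x => ε + u x) = w ^ p * z ^ q + w ^ q * z ^ p := by
  have hterm : ∀ {p q : ℕ} (v : κ → ZMod 2), p + q = Fintype.card κ → ∑ x, chi2 (v x) = p - q →
      weightTerm w z v = w ^ p * z ^ q := by
    intro p q v hpq hv
    rw [sum_chi2_eq, ← hpq] at hv
    have h1 : hammingNorm v = q := by
      have : (2 : ℂ) * hammingNorm v = 2 * q := by push_cast at hv; linear_combination -hv
      exact_mod_cast mul_left_cancel₀ two_ne_zero this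
    rw [weightTerm, h1, ← hpq, Nat.add_sub_cancel]
  have h1 : ∑ x, chi2 (1 + u x) = -∑ x, chi2 (u x) := by
    rw [← Finset.sum_neg_distrib]
    refine Finset.sum_congr rfl fun x _ => ?_
    rw [AddChar.map_add_eq_mul, chi2_one]
    ring
  rw [sum_zmod_two]
  rcases hu with hu | hu
  · rw [hterm (p := p) (q := q) _ hpq (by simpa using hu),
      hterm (p := q) (q := p) _ (by omega) (by rw [h1, hu]; ring)]
  · rw [hterm (p := q) (q := p) _ (by omega) (by simpa using hu),
      hterm (p := p) (q := q) _ hpq (by rw [h1, hu]; ring), add_comm]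

end BinaryWords

section Field

variable {F : Type*} [Field F] [Algebra (ZMod 2) F]

theorem charP_two_of_algebra : CharP F 2 :=
  charP_of_injective_algebraMap (algebraMap (ZMod 2) F).injective 2

theorem field_two_eq_zero : (2 : F) = 0 := by
  have := charP_two_of_algebra (F := F)
  exact CharTwo.two_eq_zero

theorem field_sq_injective : Function.Injective fun x : F => x ^ 2 := by
  have := charP_two_of_algebra (F := F)
  exact frobenius_inj F 2

variable [Fintype F]

/-- The canonical additive character `x ↦ (-1)^(Tr x)` of a finite field of characteristic `2`. -/
noncomputable def psi (F : Type*) [Field F] [Fintype F] [Algebra (ZMod 2) F] : AddChar F ℂ :=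
  chi2.compAddMonoidHom (Algebra.trace (ZMod 2) F).toAddMonoidHom

theorem psi_apply (x : F) : psi F x = chi2 (Algebra.trace (ZMod 2) F x) := rfl

theorem trace_sq (x : F) : Algebra.trace (ZMod 2) F (x ^ 2) = Algebra.trace (ZMod 2) F x := by
  have h := Algebra.trace_eq_of_algEquiv
    (FiniteField.frobeniusAlgEquivOfAlgebraic (ZMod 2) F) x
  rwa [FiniteField.coe_frobeniusAlgEquivOfAlgebraic, ZMod.card] at h

theorem psi_sq (x : F) : psi F (x ^ 2) = psi F x := by rw [psi_apply, psi_apply, trace_sq]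

theorem psi_eq_one_or (x : F) : psi F x = 1 ∨ psi F x = -1 := by
  rw [psi_apply]
  rcases eq_zero_or_one (Algebra.trace (ZMod 2) F x) with h | h
  · exact Or.inl (by rw [h, chi2_zero])
  · exact Or.inr (by rw [h, chi2_one])

theorem exists_psi_mul_eq_neg_one {y : F} (hy : y ≠ 0) : ∃ x, psi F (x * y) = -1 := by
  obtain ⟨x, hx⟩ : ∃ x, Algebra.trace (ZMod 2) F (x * y) ≠ 0 := by
    by_contra! h
    refine hy ((traceForm_nondegenerate (ZMod 2) F).1 y fun x => ?_)
    rw [Algebra.traceForm_apply, mul_comm]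
    exact h x
  exact ⟨x, by rw [psi_apply, (eq_zero_or_one _).resolve_left hx, chi2_one]⟩

theorem sum_psi_mul [DecidableEq F] (y : F) :
    ∑ x, psi F (x * y) = if y = 0 then (Fintype.card F : ℂ) else 0 := by
  split_ifs with hy
  · simp [hy]
  · obtain ⟨v, hv⟩ := exists_psi_mul_eq_neg_one hy
    have h1 : ∑ x, psi F (x * y) = -∑ x, psi F (x * y) := by
      conv_lhs => rw [← Equiv.sum_comp (Equiv.addRight v)]
      rw [← Finset.sum_neg_distrib]
      refine Finset.sum_congr rfl fun x _ => ?_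
      rw [Equiv.coe_addRight, add_mul, AddChar.map_add_eq_mul, hv]
      ring
    exact self_eq_neg.1 h1

variable {k : ℕ}

theorem psi_one (hF : Fintype.card F = 2 ^ (2 * k + 1)) : psi F 1 = -1 := by
  have hfin : Module.finrank (ZMod 2) F = 2 * k + 1 := by
    have h := Module.card_eq_pow_finrank (K := ZMod 2) (V := F)
    rw [hF, ZMod.card] at h
    exact (Nat.pow_right_injective le_rfl h).symm
  have h1 : Algebra.trace (ZMod 2) F 1 = 1 := by
    rw [← map_one (algebraMap (ZMod 2) F), Algebra.trace_algebraMap, hfin, nsmul_eq_mul, mul_one]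
    push_cast
    rw [show (2 : ZMod 2) = 0 by decide]
    ring
  rw [psi_apply, h1, chi2_one]

/-- Cubing is a bijection, as `3` divides `2^(2k+1) + 1`. -/
theorem cube_bijective (hF : Fintype.card F = 2 ^ (2 * k + 1)) :
    Function.Bijective fun x : F => x ^ 3 := by
  refine Finite.injective_iff_bijective.1 fun x y h => field_sq_injective ?_
  obtain ⟨j, hj⟩ : 3 ∣ 2 ^ (2 * k + 1) + 1 := by
    have : ∀ k, 2 ^ (2 * k + 1) % 3 = 2 := by
      intro k
      induction k with
      | zero => rfl
      | succ k ih => rw [show 2 * (k + 1) + 1 = 2 * k + 1 + 2 by ring, pow_add]; omega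
    have := this k
    omega
  have hx : ∀ x : F, x ^ 2 = (x ^ 3) ^ j := by
    intro x
    rw [← pow_mul, ← hj, ← hF, pow_add, FiniteField.pow_card, pow_one, pow_two]
  change x ^ 2 = y ^ 2
  rw [hx x, hx y]
  exact congrArg (· ^ j) h

/-- The Walsh transform of the cube map. -/
noncomputable def walshCube (τ : F) : ℂ := ∑ x, psi F (τ * x + x ^ 3)

theorem sum_walshCube : ∑ τ : F, walshCube τ = Fintype.card F := by
  classical
  simp_rw [walshCube, AddChar.map_add_eq_mul]
  rw [Finset.sum_comm]
  simp_rw [← Finset.sum_mul, sum_psi_mul]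
  simp

/-- The cube map is almost bent: its Walsh transform takes the values `0` and `±√(2N)` only, and the
value at `τ` is zero exactly when `τ` has trace `0`. -/
theorem walshCube_sq (hF : Fintype.card F = 2 ^ (2 * k + 1)) (τ : F) :
    walshCube τ ^ 2 = Fintype.card F * (1 - psi F τ) := by
  classical
  have h2 := field_two_eq_zero (F := F)
  have hsq : Function.Bijective fun x : F => x ^ 2 :=
    Finite.injective_iff_bijective.1 field_sq_injective
  have hterm : ∀ x v : F, psi F (τ * x + x ^ 3) * psi F (τ * (x + v ^ 2) + (x + v ^ 2) ^ 3) =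
      psi F (τ * v ^ 2 + v ^ 6) * psi F (x * (v + v ^ 4)) := by
    intro x v
    have e1 : psi F (x * (v + v ^ 4)) = psi F (x ^ 2 * v ^ 2 + x * v ^ 4) := by
      rw [mul_add, AddChar.map_add_eq_mul, AddChar.map_add_eq_mul, ← psi_sq (x * v), mul_pow]
    rw [e1, ← AddChar.map_add_eq_mul, ← AddChar.map_add_eq_mul]
    congr 1
    linear_combination (τ * x + x ^ 3 + x ^ 2 * v ^ 2 + x * v ^ 4) * h2
  have h1 : walshCube τ ^ 2 =
      ∑ v : F, psi F (τ * v ^ 2 + v ^ 6) * ∑ x, psi F (x * (v + v ^ 4)) := by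
    rw [pow_two, walshCube, Finset.sum_mul_sum]
    simp_rw [Finset.mul_sum, ← hterm]
    conv_rhs => rw [Finset.sum_comm]
    refine Finset.sum_congr rfl fun x _ => ?_
    rw [← Equiv.sum_comp (Equiv.addLeft x), ← Equiv.sum_comp (Equiv.ofBijective _ hsq)]
    rfl
  have hroots : ∀ v : F, v + v ^ 4 = 0 ↔ v = 0 ∨ v = 1 := by
    intro v
    constructor
    · intro h
      by_cases hv : v = 0
      · exact Or.inl hv
      · refine Or.inr ((cube_bijective hF).1 ?_)
        have h3 : v * (1 + v ^ 3) = 0 := by linear_combination h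
        have h4 := (mul_eq_zero.1 h3).resolve_left hv
        change v ^ 3 = 1 ^ 3
        linear_combination h4 - h2
    · rintro (rfl | rfl)
      · ring
      · linear_combination h2
  rw [h1]
  simp_rw [sum_psi_mul, hroots]
  rw [← Finset.sum_subset (Finset.subset_univ {(0 : F), 1}), Finset.sum_pair zero_ne_one]
  · simp only [true_or, or_true, if_true]
    rw [show τ * (0 : F) ^ 2 + 0 ^ 6 = 0 by ring, show τ * (1 : F) ^ 2 + 1 ^ 6 = τ + 1 by ring,
      AddChar.map_zero_eq_one, AddChar.map_add_eq_mul, psi_one hF]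
    ring
  · intro v _ hv
    have : ¬ (v = 0 ∨ v = 1) := by simpa using hv
    rw [if_neg this, mul_zero]

theorem walshCube_eq_zero (hF : Fintype.card F = 2 ^ (2 * k + 1)) {τ : F} (h : psi F τ = 1) :
    walshCube τ = 0 := by
  have := walshCube_sq hF τ
  rwa [h, sub_self, mul_zero, pow_eq_zero_iff two_ne_zero] at this

theorem walshCube_eq_or (hF : Fintype.card F = 2 ^ (2 * k + 1)) {τ : F} (h : psi F τ = -1) :
    walshCube τ = 2 * 2 ^ k ∨ walshCube τ = -(2 * 2 ^ k) := by
  have h1 := walshCube_sq hF τ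
  refine sq_eq_sq_iff_eq_or_eq_neg.1 ?_
  rw [h1, h, hF]
  push_cast
  ring

/-! ### The weight enumerator of Preparata's original code -/

/-- The Boolean function `x ↦ Tr(λ x + μ x³)`. -/
noncomputable def cubicWord (l μ : F) (x : F) : ZMod 2 :=
  Algebra.trace (ZMod 2) F (l * x + μ * x ^ 3)

theorem sum_cubicWord_mul (l μ : F) (b : F → ZMod 2) :
    ∑ x, cubicWord l μ x * b x =
      Algebra.trace (ZMod 2) F (l * powerSum b 1 + μ * powerSum b 3) := by
  rw [powerSum, powerSum, Finset.mul_sum, Finset.mul_sum, ← Finset.sum_add_distrib, map_sum]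
  refine Finset.sum_congr rfl fun x _ => ?_
  rw [cubicWord, mul_comm, ← smul_eq_mul, ← map_smul, Algebra.smul_def]
  congr 1
  ring

/-- The sum of the characters that belong to a cubic word and its complement. -/
theorem sum_chi2_cubicWord (l μ : F) (b : F → ZMod 2) :
    ∑ ε : ZMod 2, chi2 (∑ x, (ε + cubicWord l μ x) * b x) =
      (if ∑ x, b x = 0 then 2 else 0) * psi F (l * powerSum b 1 + μ * powerSum b 3) := by
  have h : ∀ ε : ZMod 2, chi2 (∑ x, (ε + cubicWord l μ x) * b x) =
      chi2 (ε * ∑ x, b x) * psi F (l * powerSum b 1 + μ * powerSum b 3) := by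
    intro ε
    simp_rw [add_mul, Finset.sum_add_distrib, ← Finset.mul_sum, sum_cubicWord_mul]
    exact AddChar.map_add_eq_mul _ _ _
  simp_rw [h, ← Finset.sum_mul, sum_chi2_mul]

theorem powerSum_add (a b : F → ZMod 2) (i : ℕ) :
    powerSum (a + b) i = powerSum a i + powerSum b i := by
  simp [powerSum, add_mul, Finset.sum_add_distrib]

theorem powerSum_zero_eq_zero_iff (a : F → ZMod 2) : powerSum a 0 = 0 ↔ ∑ x, a x = 0 := by
  rw [powerSum, ← map_eq_zero_iff _ (algebraMap (ZMod 2) F).injective]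
  simp

theorem sumElim_mem_originalPreparata_iff (b b' : F → ZMod 2) :
    Sum.elim b b' ∈ originalPreparata F ↔ ∑ x, b x = 0 ∧ ∑ x, b' x = 0 ∧
      powerSum b 1 = powerSum b' 1 ∧ powerSum b 1 ^ 3 = powerSum b 3 + powerSum b' 3 := by
  have h2 := field_two_eq_zero (F := F)
  have hself : ∀ x : F, x + x = 0 := fun x => by linear_combination x * h2
  constructor
  · rintro ⟨a, d, hc, ha0, ha1, hb0, hb⟩
    obtain ⟨rfl, rfl⟩ : b = d ∧ b' = a + d :=
      ⟨funext fun x => congrFun hc (Sum.inl x), funext fun x => congrFun hc (Sum.inr x)⟩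
    rw [powerSum_zero_eq_zero_iff] at ha0 hb0
    refine ⟨hb0, ?_, ?_, ?_⟩
    · simp [Finset.sum_add_distrib, ha0, hb0]
    · rw [powerSum_add, ha1, zero_add]
    · rw [hb, powerSum_add]
      linear_combination -(hself (powerSum b 3))
  · rintro ⟨hb, hb', h1, h3⟩
    have hself2 : ∀ a : ZMod 2, a + a = 0 := by decide
    refine ⟨b + b', b, ?_, ?_, ?_, ?_, ?_⟩
    · congr 1
      funext x
      have := hself2 (b x)
      simp only [Pi.add_apply]
      linear_combination -this
    · rw [powerSum_zero_eq_zero_iff]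
      simp [Finset.sum_add_distrib, hb, hb']
    · rw [powerSum_add, h1, hself]
    · rwa [powerSum_zero_eq_zero_iff]
    · rw [h3, powerSum_add]

/-- The indicator of the original code as a combination of characters. The nonlinear condition is
resolved by the Walsh transform `∑ₛ (-1)^Tr((λ+κ)s + μs³)`. -/
theorem sum_walsh_eq_indicator [DecidableEq F] (b b' : F → ZMod 2) :
    ∑ p : F × F × F, (∑ s, psi F ((p.2.1 + p.2.2) * s + p.1 * s ^ 3)) *
      ((∑ ε : ZMod 2, chi2 (∑ x, (ε + cubicWord p.2.1 p.1 x) * b x)) *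
        ∑ δ : ZMod 2, chi2 (∑ x, (δ + cubicWord p.2.2 p.1 x) * b' x)) =
      4 * (Fintype.card F : ℂ) ^ 3 *
        (originalPreparata F).indicator (fun _ => (1 : ℂ)) (Sum.elim b b') := by
  classical
  have h2 := field_two_eq_zero (F := F)
  have hadd : ∀ x y : F, x + y = 0 ↔ x = y := fun x y =>
    ⟨fun h => by linear_combination h - y * h2, fun h => by linear_combination h + y * h2⟩
  set S := powerSum b 1
  set S' := powerSum b' 1
  set C := powerSum b 3 + powerSum b' 3 with hC
  set c : ℂ := (if ∑ x, b x = 0 then 2 else 0) * (if ∑ x, b' x = 0 then 2 else 0)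
  have hterm : ∀ p : F × F × F, (∑ s, psi F ((p.2.1 + p.2.2) * s + p.1 * s ^ 3)) *
      ((∑ ε : ZMod 2, chi2 (∑ x, (ε + cubicWord p.2.1 p.1 x) * b x)) *
        ∑ δ : ZMod 2, chi2 (∑ x, (δ + cubicWord p.2.2 p.1 x) * b' x)) =
      ∑ s, c * (psi F (p.1 * (s ^ 3 + C)) *
        (psi F (p.2.1 * (s + S)) * psi F (p.2.2 * (s + S')))) := by
    intro p
    rw [sum_chi2_cubicWord, sum_chi2_cubicWord, Finset.sum_mul]
    refine Finset.sum_congr rfl fun s _ => ?_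
    have : psi F ((p.2.1 + p.2.2) * s + p.1 * s ^ 3) * (psi F (p.2.1 * S + p.1 * powerSum b 3) *
        psi F (p.2.2 * S' + p.1 * powerSum b' 3)) =
        psi F (p.1 * (s ^ 3 + C)) * (psi F (p.2.1 * (s + S)) * psi F (p.2.2 * (s + S'))) := by
      simp only [← AddChar.map_add_eq_mul]
      congr 1
      rw [hC]
      ring
    rw [← this]
    ring
  have hinner : ∀ s : F, ∑ p : F × F × F, c * (psi F (p.1 * (s ^ 3 + C)) *
      (psi F (p.2.1 * (s + S)) * psi F (p.2.2 * (s + S')))) =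
      if s = S then c * (Fintype.card F : ℂ) ^ 3 * (if S ^ 3 = C ∧ S = S' then 1 else 0)
        else 0 := by
    intro s
    rw [← Finset.mul_sum]
    simp_rw [Fintype.sum_prod_type, ← Finset.mul_sum, ← Finset.sum_mul, sum_psi_mul, hadd]
    by_cases h : s = S
    · subst h
      simp only [if_true]
      split_ifs <;> first | (exfalso; tauto) | ring
    · simp [h]
  simp_rw [hterm]
  rw [Finset.sum_comm]
  simp_rw [hinner]
  rw [Finset.sum_ite_eq' Finset.univ S, if_pos (Finset.mem_univ _)]
  by_cases hmem : Sum.elim b b' ∈ originalPreparata F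
  · obtain ⟨hb, hb', h1, h3⟩ := (sumElim_mem_originalPreparata_iff b b').1 hmem
    rw [Set.indicator_of_mem hmem, if_pos ⟨h3, h1⟩]
    simp only [c, hb, hb', if_true]
    ring
  · rw [Set.indicator_of_notMem hmem, mul_zero]
    by_cases hb : ∑ x, b x = 0
    · by_cases hb' : ∑ x, b' x = 0
      · rw [if_neg, mul_zero]
        exact fun h => hmem ((sumElim_mem_originalPreparata_iff b b').2 ⟨hb, hb', h.2, h.1⟩)
      · simp [c, hb']
    · simp [c, hb]

/-- The weight enumerator of Preparata's original code of length `2N`, `N = 2^(2k+1)`. -/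
theorem hasPreparataEnumerator_originalPreparata {N : ℕ} (hF : Fintype.card F = N)
    (hN : N = 2 ^ (2 * k + 1)) : HasPreparataEnumerator (originalPreparata F) k N := by
  intro w z
  classical
  have hF' := hF.trans hN
  have hN0 : (N : ℂ) ≠ 0 := by
    rw [hN]
    exact_mod_cast (pow_pos two_pos _).ne'
  set P := w + z with hP
  set Q := w - z with hQ
  set M := 2 ^ (2 * k) with hM
  have hNM : N = 2 * M := by rw [hN, hM]; ring
  have hkM : 2 ^ k ≤ M := Nat.pow_le_pow_right (by norm_num) (by omega)
  -- the contribution of a cubic word and its complement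
  set H : F → F → ℂ := fun l μ => ∑ ε : ZMod 2, weightTerm P Q (fun x => ε + cubicWord l μ x)
    with hH
  have hHdef : ∀ l μ, H l μ = ∑ ε : ZMod 2, weightTerm P Q (fun x => ε + cubicWord l μ x) :=
    fun _ _ => rfl
  have hexpand : 4 * (N : ℂ) ^ 3 * weightEnum (originalPreparata F) w z =
      ∑ p : F × F × F, (∑ s, psi F ((p.2.1 + p.2.2) * s + p.1 * s ^ 3)) *
        (H p.2.1 p.1 * H p.2.2 p.1) := by
    have h1 : weightEnum (originalPreparata F) w z = ∑ q : (F → ZMod 2) × (F → ZMod 2),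
        (originalPreparata F).indicator (fun _ => (1 : ℂ)) (Sum.elim q.1 q.2) *
          (weightTerm w z q.1 * weightTerm w z q.2) := by
      rw [weightEnum_eq_sum_indicator,
        ← Equiv.sum_comp (Equiv.sumArrowEquivProdArrow F F (ZMod 2)).symm]
      refine Finset.sum_congr rfl fun q _ => ?_
      change (originalPreparata F).indicator (weightTerm w z) (Sum.elim q.1 q.2) = _
      rw [← weightTerm_sumElim]
      by_cases h : Sum.elim q.1 q.2 ∈ originalPreparata F <;> simp [h]
    have h2 : ∀ l μ, H l μ = ∑ b : F → ZMod 2, weightTerm w z b *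
        ∑ ε : ZMod 2, chi2 (∑ x, (ε + cubicWord l μ x) * b x) := by
      intro l μ
      simp_rw [hH, Finset.mul_sum]
      rw [Finset.sum_comm]
      refine Finset.sum_congr rfl fun ε _ => ?_
      rw [sum_weightTerm_mul_chi2]
    have h3 : ∀ l l' μ, H l μ * H l' μ = ∑ q : (F → ZMod 2) × (F → ZMod 2),
        (weightTerm w z q.1 * weightTerm w z q.2) *
          ((∑ ε : ZMod 2, chi2 (∑ x, (ε + cubicWord l μ x) * q.1 x)) *
            ∑ δ : ZMod 2, chi2 (∑ x, (δ + cubicWord l' μ x) * q.2 x)) := by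
      intro l l' μ
      rw [h2, h2, Finset.sum_mul_sum, Fintype.sum_prod_type]
      exact Finset.sum_congr rfl fun b _ => Finset.sum_congr rfl fun b' _ => by ring
    simp_rw [h3, Finset.mul_sum (s := (Finset.univ : Finset ((F → ZMod 2) × (F → ZMod 2))))]
    rw [Finset.sum_comm, h1, Finset.mul_sum]
    refine Finset.sum_congr rfl fun q _ => ?_
    have h4 := sum_walsh_eq_indicator q.1 q.2
    rw [hF] at h4
    rw [← mul_assoc, ← h4, Finset.sum_mul]
    exact Finset.sum_congr rfl fun p _ => by ring
  -- the values of the character sums of the words with `μ = 0`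
  have hHlin : ∀ l, H l 0 = if l = 0 then P ^ N + Q ^ N else 2 * (P ^ M * Q ^ M) := by
    intro l
    have hsum : ∑ x, chi2 (cubicWord l 0 x) = if l = 0 then (N : ℂ) else 0 := by
      rw [← hF, ← sum_psi_mul]
      refine Finset.sum_congr rfl fun x _ => ?_
      rw [psi_apply, cubicWord, zero_mul, add_zero, mul_comm]
    split_ifs at hsum ⊢ with hl
    · rw [hHdef, sum_weightTerm_add (p := N) (q := 0) (by rw [hF, add_zero]) P Q _
        (Or.inl (by rw [hsum]; simp))]
      simp
    · rw [hHdef, sum_weightTerm_add (p := M) (q := M) (by rw [hF, hNM]; ring) P Q _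
        (Or.inl (by rw [hsum, sub_self]))]
      ring
  have hlin : ∑ q : F × F, (∑ s, psi F ((q.1 + q.2) * s + 0 * s ^ 3)) * (H q.1 0 * H q.2 0) =
      N * (P ^ (2 * N) + Q ^ (2 * N) + (4 * N - 2) * (P ^ N * Q ^ N)) := by
    have h2 := field_two_eq_zero (F := F)
    have hadd : ∀ x y : F, x + y = 0 ↔ x = y := fun x y =>
      ⟨fun h => by linear_combination h - y * h2, fun h => by linear_combination h + y * h2⟩
    have h1 : ∀ y : F, ∑ s, psi F (y * s + 0 * s ^ 3) = if y = 0 then (N : ℂ) else 0 := by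
      intro y
      rw [← hF, ← sum_psi_mul]
      exact Finset.sum_congr rfl fun x _ => by rw [zero_mul, add_zero, mul_comm]
    simp_rw [h1, hadd, Fintype.sum_prod_type, ite_mul, zero_mul, Finset.sum_ite_eq,
      Finset.mem_univ, if_true, hHlin]
    rw [← Finset.add_sum_erase _ _ (Finset.mem_univ 0), if_pos rfl,
      Finset.sum_congr rfl fun l hl => by rw [if_neg (Finset.ne_of_mem_erase hl)],
      Finset.sum_const, Finset.card_erase_of_mem (Finset.mem_univ _), Finset.card_univ, hF,
      nsmul_eq_mul, Nat.cast_sub (by rw [hN]; exact Nat.one_le_two_pow), hNM]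
    push_cast
    ring
  -- all `μ = θ³ ≠ 0` contribute alike
  have hcub : ∀ μ : F, μ ≠ 0 →
      ∑ q : F × F, (∑ s, psi F ((q.1 + q.2) * s + μ * s ^ 3)) * (H q.1 μ * H q.2 μ) =
      2 * N ^ 2 * (P ^ (N + 2 ^ k) * Q ^ (N - 2 ^ k) + P ^ (N - 2 ^ k) * Q ^ (N + 2 ^ k)) := by
    intro μ hμ
    obtain ⟨θ, hθ⟩ := (cube_bijective hF').2 μ
    change θ ^ 3 = μ at hθ
    have hθ0 : θ ≠ 0 := by
      rintro rfl
      exact hμ (by rw [← hθ]; ring)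
    have hmul : ∀ y, Equiv.mulLeft₀ θ hθ0 y = θ * y := fun _ => rfl
    have hwalsh : ∀ y, ∑ s, psi F (θ * y * s + μ * s ^ 3) = walshCube y := by
      intro y
      rw [walshCube]
      conv_rhs => rw [← Equiv.sum_comp (Equiv.mulLeft₀ θ hθ0)]
      refine Finset.sum_congr rfl fun s _ => ?_
      rw [hmul, ← hθ]
      congr 1
      ring
    have hH0 : ∀ y, psi F y = 1 → H (θ * y) μ = 2 * (P ^ M * Q ^ M) := by
      intro y hy
      have hsum : ∑ x, chi2 (cubicWord (θ * y) μ x) = 0 := by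
        rw [← walshCube_eq_zero hF' hy, ← hwalsh]
        rfl
      rw [hHdef, sum_weightTerm_add (p := M) (q := M) (by rw [hF, hNM]; ring) P Q _
        (Or.inl (by rw [hsum, sub_self]))]
      ring
    have hH1 : ∀ y, psi F y = -1 → H (θ * y) μ =
        P ^ (M + 2 ^ k) * Q ^ (M - 2 ^ k) + P ^ (M - 2 ^ k) * Q ^ (M + 2 ^ k) := by
      intro y hy
      have hsum : ∑ x, chi2 (cubicWord (θ * y) μ x) = walshCube y := by
        rw [← hwalsh]
        rfl
      rw [hHdef, sum_weightTerm_add (p := M + 2 ^ k) (q := M - 2 ^ k) 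
        (by rw [hF, hNM]; omega) P Q _]
      rw [hsum, Nat.cast_sub hkM]
      push_cast
      rcases walshCube_eq_or hF' hy with h | h
      · exact Or.inl (by rw [h]; ring)
      · exact Or.inr (by rw [h]; ring)
    set G := P ^ (N + 2 ^ k) * Q ^ (N - 2 ^ k) + P ^ (N - 2 ^ k) * Q ^ (N + 2 ^ k) with hG
    have hHH : 2 * (P ^ M * Q ^ M) *
        (P ^ (M + 2 ^ k) * Q ^ (M - 2 ^ k) + P ^ (M - 2 ^ k) * Q ^ (M + 2 ^ k)) = 2 * G := by
      rw [hG, show N + 2 ^ k = M + (M + 2 ^ k) by omega, show N - 2 ^ k = M + (M - 2 ^ k) by omega,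
        pow_add P M, pow_add Q M, pow_add P M, pow_add Q M]
      ring
    -- the Walsh transform vanishes at `y + y'` unless `y`, `y'` have different traces
    have hpair : ∀ y y', walshCube (y + y') * (H (θ * y) μ * H (θ * y') μ) =
        walshCube (y + y') * (2 * G) := by
      intro y y'
      rcases psi_eq_one_or y with hy | hy <;> rcases psi_eq_one_or y' with hy' | hy'
      · rw [walshCube_eq_zero hF' (by rw [AddChar.map_add_eq_mul, hy, hy', one_mul]), zero_mul,
          zero_mul]
      · rw [hH0 y hy, hH1 y' hy', hHH]
      · rw [hH1 y hy, hH0 y' hy', mul_comm (_ + _) (2 * _), hHH]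
      · rw [walshCube_eq_zero hF' (by rw [AddChar.map_add_eq_mul, hy, hy']; ring), zero_mul,
          zero_mul]
    rw [Fintype.sum_prod_type, ← Equiv.sum_comp (Equiv.mulLeft₀ θ hθ0)]
    have hrow : ∀ y, ∑ q : F, (∑ s, psi F ((Equiv.mulLeft₀ θ hθ0 y + q) * s + μ * s ^ 3)) *
        (H (Equiv.mulLeft₀ θ hθ0 y) μ * H q μ) = N * (2 * G) := by
      intro y
      rw [← Equiv.sum_comp (Equiv.mulLeft₀ θ hθ0)]
      simp_rw [hmul, ← mul_add, hwalsh, hpair, ← Finset.sum_mul]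
      congr 1
      rw [← hF, ← sum_walshCube, ← Equiv.sum_comp (Equiv.addLeft y) walshCube]
      rfl
    simp_rw [hrow]
    rw [Finset.sum_const, Finset.card_univ, hF, nsmul_eq_mul]
    ring
  have hmain : 4 * (N : ℂ) ^ 3 * weightEnum (originalPreparata F) w z =
      N * (P ^ (2 * N) + Q ^ (2 * N) + (4 * N - 2) * (P ^ N * Q ^ N)) +
      (N - 1) * (2 * N ^ 2 *
        (P ^ (N + 2 ^ k) * Q ^ (N - 2 ^ k) + P ^ (N - 2 ^ k) * Q ^ (N + 2 ^ k))) := by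
    rw [hexpand, Fintype.sum_prod_type, ← Finset.add_sum_erase _ _ (Finset.mem_univ 0), hlin,
      Finset.sum_congr rfl fun μ hμ => hcub μ (Finset.ne_of_mem_erase hμ),
      Finset.sum_const, Finset.card_erase_of_mem (Finset.mem_univ _), Finset.card_univ, hF,
      nsmul_eq_mul, Nat.cast_sub (by rw [hN]; exact Nat.one_le_two_pow), Nat.cast_one]
  refine mul_left_cancel₀ hN0 ?_
  linear_combination hmain

end Field

/-! ### Low weights -/

section Coefficients

/-- The logarithmic derivative of `(1 + X)^a (1 - X)^b`, cleared of denominators. -/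
theorem derivative_one_add_pow_mul_one_sub_pow (a b : ℕ) :
    derivative ((1 + X : ℂ[X]) ^ a * (1 - X) ^ b) * (1 - X ^ 2) =
      (C ((a : ℂ) - b) - C ((a : ℂ) + b) * X) * ((1 + X) ^ a * (1 - X) ^ b) := by
  have h1 : ∀ a : ℕ, derivative ((1 + X : ℂ[X]) ^ a) * (1 + X) = C (a : ℂ) * (1 + X) ^ a := by
    intro a
    cases a with
    | zero => simp
    | succ a =>
      rw [derivative_pow_succ]
      simp [pow_succ]
      ring
  have h2 : ∀ b : ℕ, derivative ((1 - X : ℂ[X]) ^ b) * (1 - X) = -C (b : ℂ) * (1 - X) ^ b := by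
    intro b
    cases b with
    | zero => simp
    | succ b =>
      rw [derivative_pow_succ]
      simp [pow_succ]
      ring
  rw [derivative_mul, C_sub, C_add]
  linear_combination ((1 - X) ^ b * (1 - X)) * h1 a + ((1 + X) ^ a * (1 + X)) * h2 b

/-- The first coefficients of `(1 + X)^a (1 - X)^b`, that is, values of Krawtchouk polynomials, in
terms of `d = a - b` and `s = a + b`. -/
theorem coeff_one_add_pow_mul_one_sub_pow (a b : ℕ) {d s : ℂ} (hd : (a : ℂ) - b = d)
    (hs : (a : ℂ) + b = s) :
    let q := ((1 + X : ℂ[X]) ^ a * (1 - X) ^ b).coeff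
    q 1 = d ∧ 2 * q 2 = d ^ 2 - s ∧ 6 * q 3 = d ^ 3 - (3 * s - 2) * d ∧
      24 * q 4 = d ^ 4 - (6 * s - 8) * d ^ 2 + 3 * s * (s - 2) ∧
      120 * q 5 = d ^ 5 - (10 * s - 20) * d ^ 3 + (15 * s ^ 2 - 50 * s + 24) * d ∧
      720 * q 6 = d ^ 6 - (15 * s - 40) * d ^ 4 + (45 * s ^ 2 - 210 * s + 184) * d ^ 2 -
        15 * s * (s - 2) * (s - 4) := by
  intro q
  have hK := derivative_one_add_pow_mul_one_sub_pow a b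
  rw [hd, hs] at hK
  set K := (1 + X : ℂ[X]) ^ a * (1 - X) ^ b with hKdef
  have h0 : K.coeff 0 = 1 := by
    rw [coeff_zero_eq_eval_zero, hKdef]
    simp
  have hK' : derivative K - derivative K * X ^ 2 = C d * K - C s * (K * X ^ 1) := by
    linear_combination hK
  have e (n : ℕ) := congrArg (coeff · n) hK'
  simp only [coeff_sub, coeff_derivative, coeff_C_mul, coeff_mul_X_pow'] at e
  have e0 := e 0
  have e1 := e 1
  have e2 := e 2
  have e3 := e 3
  have e4 := e 4
  have e5 := e 5
  norm_num [h0] at e0 e1 e2 e3 e4 e5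
  change _ = _ at e0
  have q1 : q 1 = d := e0
  have q2 : 2 * q 2 = d ^ 2 - s := by linear_combination e1 + d * q1
  have q3 : 6 * q 3 = d ^ 3 - (3 * s - 2) * d := by
    linear_combination 2 * e2 + d * q2 + (2 - 2 * s) * q1
  have q4 : 24 * q 4 = d ^ 4 - (6 * s - 8) * d ^ 2 + 3 * s * (s - 2) := by
    linear_combination 6 * e3 + d * q3 + (6 - 3 * s) * q2
  have q5 : 120 * q 5 = d ^ 5 - (10 * s - 20) * d ^ 3 + (15 * s ^ 2 - 50 * s + 24) * d := by
    linear_combination 24 * e4 + d * q4 + (12 - 4 * s) * q3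
  have q6 : 720 * q 6 = d ^ 6 - (15 * s - 40) * d ^ 4 + (45 * s ^ 2 - 210 * s + 184) * d ^ 2 -
      15 * s * (s - 2) * (s - 4) := by
    linear_combination 120 * e5 + d * q5 + (20 - 5 * s) * q4
  exact ⟨q1, q2, q3, q4, q5, q6⟩

namespace HasPreparataEnumerator

variable {κ : Type*} [Fintype κ] {C : Set (κ → ZMod 2)} {k N : ℕ}

theorem smul_weightPoly (h : HasPreparataEnumerator C k N) :
    Polynomial.C (4 * (N : ℂ) ^ 2) * weightPoly C =
      (1 + X) ^ (2 * N) * (1 - X) ^ 0 + (1 + X) ^ 0 * (1 - X) ^ (2 * N) +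
        Polynomial.C (4 * (N : ℂ) - 2) * ((1 + X) ^ N * (1 - X) ^ N) +
        Polynomial.C (2 * (N : ℂ) * (N - 1)) * ((1 + X) ^ (N + 2 ^ k) * (1 - X) ^ (N - 2 ^ k) +
          (1 + X) ^ (N - 2 ^ k) * (1 - X) ^ (N + 2 ^ k)) := by
  refine Polynomial.funext fun z => ?_
  rw [eval_mul, eval_C, eval_weightPoly, h]
  simp

theorem coeff_eq (h : HasPreparataEnumerator C k N) (i : ℕ) :
    4 * (N : ℂ) ^ 2 * weightDistribution C i =
      ((1 + X : ℂ[X]) ^ (2 * N) * (1 - X) ^ 0).coeff i +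
        ((1 + X : ℂ[X]) ^ 0 * (1 - X) ^ (2 * N)).coeff i +
        (4 * (N : ℂ) - 2) * ((1 + X : ℂ[X]) ^ N * (1 - X) ^ N).coeff i +
        (2 * (N : ℂ) * (N - 1)) * (((1 + X : ℂ[X]) ^ (N + 2 ^ k) * (1 - X) ^ (N - 2 ^ k)).coeff i +
          ((1 + X : ℂ[X]) ^ (N - 2 ^ k) * (1 - X) ^ (N + 2 ^ k)).coeff i) := by
  have := congrArg (coeff · i) h.smul_weightPoly
  simp only [coeff_add, coeff_C_mul, coeff_weightPoly] at this
  exact this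

/-- There are no words of weight `1, …, 5`, and `s(s-1)(s-2)(s-4)/360` words of weight `6`, where
`s = 2N` is the length. -/
theorem weightDistribution_low (h : HasPreparataEnumerator C k N) (hN : N = 2 ^ (2 * k + 1))
    (hk : 1 ≤ k) :
    (∀ i, 0 < i → i < 6 → weightDistribution C i = 0) ∧ weightDistribution C 6 ≠ 0 := by
  have hkN : 2 ^ k ≤ N := by
    rw [hN]
    exact Nat.pow_le_pow_right (by norm_num) (by omega)
  have hr : (2 * (2 : ℂ) ^ k) ^ 2 = 2 * N := by
    rw [hN]
    push_cast
    ring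
  have hN8 : 8 ≤ N := by
    rw [hN]
    calc 8 = 2 ^ 3 := by norm_num
      _ ≤ 2 ^ (2 * k + 1) := Nat.pow_le_pow_right (by norm_num) (by omega)
  have hN0 : (N : ℂ) ≠ 0 := by exact_mod_cast (by omega : N ≠ 0)
  set r : ℂ := 2 * 2 ^ k with hrdef
  obtain ⟨a1, a2, a3, a4, a5, a6⟩ := coeff_one_add_pow_mul_one_sub_pow (2 * N) 0 (d := 2 * N)
    (s := 2 * N) (by push_cast; ring) (by push_cast; ring)
  obtain ⟨b1, b2, b3, b4, b5, b6⟩ := coeff_one_add_pow_mul_one_sub_pow 0 (2 * N) (d := -(2 * N))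
    (s := 2 * N) (by push_cast; ring) (by push_cast; ring)
  obtain ⟨c1, c2, c3, c4, c5, c6⟩ := coeff_one_add_pow_mul_one_sub_pow N N (d := 0)
    (s := 2 * N) (by ring) (by ring)
  obtain ⟨p1, p2, p3, p4, p5, p6⟩ := coeff_one_add_pow_mul_one_sub_pow (N + 2 ^ k) (N - 2 ^ k)
    (d := r) (s := 2 * N) (by rw [Nat.cast_sub hkN]; push_cast; ring)
    (by rw [Nat.cast_sub hkN]; push_cast; ring)
  obtain ⟨m1, m2, m3, m4, m5, m6⟩ := coeff_one_add_pow_mul_one_sub_pow (N - 2 ^ k) (N + 2 ^ k)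
    (d := -r) (s := 2 * N) (by rw [Nat.cast_sub hkN]; push_cast; ring)
    (by rw [Nat.cast_sub hkN]; push_cast; ring)
  have h4 : (4 * (N : ℂ) ^ 2) ≠ 0 := mul_ne_zero (by norm_num) (pow_ne_zero 2 hN0)
  have w1 : 4 * (N : ℂ) ^ 2 * weightDistribution C 1 = 0 := by
    rw [h.coeff_eq, a1, b1, c1, p1, m1]; ring
  have w2 : 4 * (N : ℂ) ^ 2 * weightDistribution C 2 = 0 := by
    rw [h.coeff_eq]
    linear_combination (1 / 2 : ℂ) * (a2 + b2 + (4 * N - 2) * c2 + 2 * N * (N - 1) * (p2 + m2)) +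
      2 * N * (N - 1) * hr
  have w3 : 4 * (N : ℂ) ^ 2 * weightDistribution C 3 = 0 := by
    rw [h.coeff_eq]
    linear_combination (1 / 6 : ℂ) * (a3 + b3 + (4 * N - 2) * c3 + 2 * N * (N - 1) * (p3 + m3))
  have w4 : 4 * (N : ℂ) ^ 2 * weightDistribution C 4 = 0 := by
    rw [h.coeff_eq]
    linear_combination (1 / 24 : ℂ) * (a4 + b4 + (4 * N - 2) * c4 + 2 * N * (N - 1) * (p4 + m4)) +
      (1 / 24 : ℂ) * (4 * N * (N - 1)) * (r ^ 2 + 2 * N - (12 * N - 8)) * hr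
  have w5 : 4 * (N : ℂ) ^ 2 * weightDistribution C 5 = 0 := by
    rw [h.coeff_eq]
    linear_combination (1 / 120 : ℂ) * (a5 + b5 + (4 * N - 2) * c5 + 2 * N * (N - 1) * (p5 + m5))
  have w6 : 720 * (4 * (N : ℂ) ^ 2 * weightDistribution C 6) =
      2 * (2 * N) ^ 3 * (2 * N - 1) * (2 * N - 2) * (2 * N - 4) := by
    rw [h.coeff_eq]
    linear_combination a6 + b6 + (4 * N - 2) * c6 + 2 * N * (N - 1) * (p6 + m6) +
      (4 * N * (N - 1)) * (r ^ 4 + r ^ 2 * (2 * N) + (2 * N) ^ 2 - (30 * N - 40) * (r ^ 2 + 2 * N) +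
        (45 * (2 * N) ^ 2 - 210 * (2 * N) + 184)) * hr
  have hz : ∀ i, 4 * (N : ℂ) ^ 2 * weightDistribution C i = 0 → weightDistribution C i = 0 :=
    fun i hi => by exact_mod_cast (mul_eq_zero.1 hi).resolve_left h4
  constructor
  · intro i hi0 hi6
    interval_cases i
    exacts [hz 1 w1, hz 2 w2, hz 3 w3, hz 4 w4, hz 5 w5]
  · intro h6
    rw [h6, Nat.cast_zero, mul_zero, mul_zero] at w6
    obtain ⟨n, rfl⟩ : ∃ n, N = n + 3 := ⟨N - 3, by omega⟩
    have hpos : ((2 * (2 * (n + 3)) ^ 3 * (2 * n + 5) * (2 * n + 4) * (2 * n + 2) : ℕ) : ℂ) ≠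
        0 := by
      exact_mod_cast (by positivity : (0 : ℕ) < _).ne'
    refine hpos ?_
    push_cast at w6 ⊢
    linear_combination -w6

theorem ncard_eq (h : HasPreparataEnumerator C k N) (hN : N = 2 ^ (2 * k + 1)) :
    C.ncard = 2 ^ (2 * N - (2 * (2 * k + 1) + 2)) := by
  have hkN : 2 ^ k < N := by
    rw [hN]
    exact Nat.pow_lt_pow_right (by norm_num) (by omega)
  have hN0 : N ≠ 0 := (Nat.zero_lt_of_lt hkN).ne'
  have h1 := h 1 1
  rw [weightEnum_one_one, sub_self, zero_pow (mul_ne_zero two_ne_zero hN0),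
    zero_pow (hN0), zero_pow (Nat.sub_ne_zero_of_lt hkN),
    zero_pow (show N + 2 ^ k ≠ 0 from fun h => hN0 (Nat.eq_zero_of_add_eq_zero_right h))] at h1
  have h2 : 4 * N ^ 2 * C.ncard = 2 ^ (2 * N) := by
    have h3 : 4 * (N : ℂ) ^ 2 * C.ncard = 2 ^ (2 * N) := by
      rw [h1]
      norm_num
    exact_mod_cast h3
  have h3 : 4 * N ^ 2 = 2 ^ (2 * (2 * k + 1) + 2) := by rw [hN]; ring
  rw [h3] at h2
  have hle : 2 * (2 * k + 1) + 2 ≤ 2 * N := by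
    have := Nat.lt_two_pow_self (n := 2 * k + 1)
    rw [← hN] at this
    omega
  rw [← Nat.add_sub_of_le hle, pow_add 2 (2 * (2 * k + 1) + 2)] at h2
  exact Nat.eq_of_mul_eq_mul_left (pow_pos two_pos (2 * (2 * k + 1) + 2)) h2

end HasPreparataEnumerator

end Coefficients

/-! ### Nonlinearity -/

/-- The Gray image of a quaternary code is linear only if the code contains all `2 a b`. -/
theorem two_mul_mul_mem_of_isLinear {ι : Type*} {C : Code4 ι} (h : IsLinear (binaryImage C))
    {a b : ι → ZMod 4} (ha : a ∈ C) (hb : b ∈ C) : 2 * (a * b) ∈ C := by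
  obtain ⟨S, hS⟩ := h
  have hmem : ∀ x, x ∈ S ↔ x ∈ binaryImage C := fun x => by rw [← hS]; rfl
  have h1 : gray a + gray b ∈ S :=
    S.add_mem ((hmem _).2 ⟨a, ha, rfl⟩) ((hmem _).2 ⟨b, hb, rfl⟩)
  rw [gray_add_gray, hmem] at h1
  obtain ⟨c, hc, h2⟩ := h1
  have h3 : a + b + 2 * (a * b) ∈ C := by rw [← gray_injective h2]; exact hc
  have h4 := C.sub_mem h3 (C.add_mem ha hb)
  rwa [add_sub_cancel_left] at h4

section

variable {m : ℕ} {ι R F : Type*} [CommRing R] [Field F] {red : R →+* F} {t : ι → R} [Fintype ι]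

namespace IsTeichmuller

/-- The quaternary word with entries `1` at the Teichmüller representatives of `A` and `0`
elsewhere. -/
def indicatorWord [DecidableEq F] (red : R →+* F) (t : ι → R) (A : Finset F) (j : ι) : ZMod 4 :=
  if red (t j) ∈ A then 1 else 0

theorem sum_indicatorWord [DecidableEq F] (ht : IsTeichmuller red t) (A : Finset F) :
    ∑ j, indicatorWord red t A j = A.card := by
  classical
  let e : ι ≃ F := Equiv.ofBijective _ ht.bijective
  let _ : Fintype F := Fintype.ofEquiv ι e
  have h := Equiv.sum_comp e fun y => if y ∈ A then (1 : ZMod 4) else 0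
  change ∑ j, indicatorWord red t A j = _ at h
  rw [h, Finset.sum_boole, Finset.filter_mem_eq_inter, Finset.univ_inter]

variable [Algebra (ZMod 4) R]

theorem exists_sum_smul_eq [DecidableEq ι] (ht : IsTeichmuller red t)
    (bs : Module.Basis (Fin m) (ZMod 4) R) (hcard : Fintype.card ι = 2 ^ m) (y : R) :
    ∃ e : ι → ZMod 4, ∑ j, e j = 0 ∧ ∑ j, e j • t j = y := by
  classical
  let _ : Fintype R := Fintype.ofEquiv _ bs.equivFun.toEquiv.symm
  have hunit : ∀ u, red u ≠ 0 → ∃ e : ι → ZMod 4, ∑ j, e j = 0 ∧ ∑ j, e j • t j = u := by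
    intro u hu
    have hmem : u ∈ Finset.univ.filter fun u => red u ≠ 0 := by simpa using hu
    rw [← ht.image_sub_offDiag bs hcard] at hmem
    obtain ⟨⟨a, b⟩, -, rfl⟩ := Finset.mem_image.1 hmem
    refine ⟨Pi.single a 1 - Pi.single b 1, ?_, ?_⟩
    · simp
    · simp [sub_smul, Pi.single_apply, ite_smul]
  by_cases hy : red y = 0
  · obtain ⟨e, he, he'⟩ := hunit (y + 1) (by rw [map_add, hy, map_one, zero_add]; exact one_ne_zero)
    obtain ⟨f, hf, hf'⟩ := hunit 1 (by rw [map_one]; exact one_ne_zero)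
    refine ⟨e - f, ?_, ?_⟩
    · simp [he, hf]
    · simp [sub_smul, he', hf']
  · exact hunit y hy

variable [DecidableEq F]

theorem red_sum_indicatorWord (ht : IsTeichmuller red t) (A : Finset F) :
    red (∑ j, indicatorWord red t A j • t j) = ∑ y ∈ A, y := by
  classical
  let e : ι ≃ F := Equiv.ofBijective _ ht.bijective
  let _ : Fintype F := Fintype.ofEquiv ι e
  have h := Equiv.sum_comp e fun y => if y ∈ A then y else 0
  rw [Finset.sum_ite_mem, Finset.univ_inter] at h
  rw [← h, map_sum]
  refine Finset.sum_congr rfl fun j _ => ?_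
  change red (indicatorWord red t A j • t j) = if red (t j) ∈ A then red (t j) else 0
  rw [indicatorWord]
  split_ifs <;> simp

/-- Modulo `2`, the dual of the Kerdock code is the extended Hamming code. -/
theorem exists_mem_dual_affineCode [DecidableEq ι] (ht : IsTeichmuller red t)
    (bs : Module.Basis (Fin m) (ZMod 4) R)
    (hcard : Fintype.card ι = 2 ^ m) (A : Finset F) (hA : 4 ∣ A.card) (hA' : ∑ y ∈ A, y = 0) :
    ∃ e : ι → ZMod 4, indicatorWord red t A - 2 * e ∈ dual (affineCode t) := by
  have : Module.Free (ZMod 4) R := Module.Free.of_basis bs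
  obtain ⟨y, hy⟩ := (ht.red_eq_zero_iff _).1 ((ht.red_sum_indicatorWord A).trans hA')
  obtain ⟨e, he, he'⟩ := ht.exists_sum_smul_eq bs hcard y
  refine ⟨e, (mem_dual_affineCode_iff t _).2 ⟨?_, ?_⟩⟩
  · have h1 : ((A.card : ℕ) : ZMod 4) = 0 := (ZMod.natCast_eq_zero_iff _ _).2 hA
    have h2 : ∑ j, (indicatorWord red t A - 2 * e) j =
        ∑ j, indicatorWord red t A j - 2 * ∑ j, e j := by
      rw [Finset.mul_sum, ← Finset.sum_sub_distrib]
      rfl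
    rw [h2, ht.sum_indicatorWord, h1, he, mul_zero, sub_zero]
  · have h2 : ∑ j, (indicatorWord red t A - 2 * e) j • t j =
        ∑ j, indicatorWord red t A j • t j - 2 * ∑ j, e j • t j := by
      rw [Finset.mul_sum, ← Finset.sum_sub_distrib]
      refine Finset.sum_congr rfl fun j _ => ?_
      rw [Pi.sub_apply, sub_smul]
      congr 1
      rw [show (2 * e) j = 2 * e j from rfl, mul_smul, Algebra.smul_def (2 : ZMod 4)]
      congr 1
      exact map_ofNat _ 2
    rw [h2, he', hy, sub_self]

/-- If the binary Preparata-like code were linear, then the extended Hamming code would be closed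
under products; but the planes `{0, 1, u, u+1}` and `{0, 1, v, v+1}` meet in `{0, 1}`. -/
theorem not_isLinear (ht : IsTeichmuller red t) (bs : Module.Basis (Fin m) (ZMod 4) R)
    (hcard : Fintype.card ι = 2 ^ m) (hm : 3 ≤ m) :
    ¬ IsLinear (binaryImage (dual (affineCode t))) := by
  classical
  intro hlin
  have : Module.Free (ZMod 4) R := Module.Free.of_basis bs
  let _ : Fintype F := Fintype.ofEquiv ι (Equiv.ofBijective _ ht.bijective)
  have hF : 8 ≤ (Finset.univ : Finset F).card := by
    rw [Finset.card_univ, ← Fintype.card_congr (Equiv.ofBijective _ ht.bijective), hcard]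
    calc 8 = 2 ^ 3 := by norm_num
      _ ≤ 2 ^ m := Nat.pow_le_pow_right (by norm_num) hm
  have h2 := ht.two_eq_zero
  have hone : (1 : F) + 1 = 0 := by linear_combination h2
  have hself : ∀ x y : F, x + 1 = y → x = y + 1 := fun x y h => by
    linear_combination h - hone
  obtain ⟨u, -, hu⟩ := Finset.exists_mem_notMem_of_card_lt_card
    (lt_of_le_of_lt (Finset.card_le_two (a := (0 : F)) (b := 1))
      (by omega : 2 < (Finset.univ : Finset F).card))
  obtain ⟨v, -, hv⟩ := Finset.exists_mem_notMem_of_card_lt_card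
    (lt_of_le_of_lt (Finset.card_le_four (a := (0 : F)) (b := 1) (c := u) (d := u + 1))
      (by omega : 4 < (Finset.univ : Finset F).card))
  simp only [Finset.mem_insert, Finset.mem_singleton, not_or] at hu hv
  have plane : ∀ x : F, x ≠ 0 → x ≠ 1 →
      ({0, 1, x, x + 1} : Finset F).card = 4 ∧ ∑ y ∈ ({0, 1, x, x + 1} : Finset F), y = 0 := by
    intro x hx0 hx1
    have n1 : (0 : F) ∉ ({1, x, x + 1} : Finset F) := by
      simp only [Finset.mem_insert, Finset.mem_singleton, not_or]
      exact ⟨zero_ne_one, hx0.symm, fun h => hx1 (by simpa using hself x 0 h.symm)⟩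
    have n2 : (1 : F) ∉ ({x, x + 1} : Finset F) := by
      simp only [Finset.mem_insert, Finset.mem_singleton, not_or]
      exact ⟨hx1.symm, fun h => hx0 (by simpa using h.symm)⟩
    have n3 : x ∉ ({x + 1} : Finset F) := by simp
    refine ⟨by simp [Finset.card_insert_of_notMem, n1, n2, n3], ?_⟩
    rw [Finset.sum_insert n1, Finset.sum_insert n2, Finset.sum_insert n3, Finset.sum_singleton]
    linear_combination (1 + x) * h2
  have hinter : ({0, 1, u, u + 1} : Finset F) ∩ {0, 1, v, v + 1} = {0, 1} := by
    ext y
    simp only [Finset.mem_inter, Finset.mem_insert, Finset.mem_singleton]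
    constructor
    · rintro ⟨h | h | h, h'⟩
      · exact Or.inl h
      · exact Or.inr h
      rcases h' with h' | h' | h'
      · exact Or.inl h'
      · exact Or.inr h'
      exfalso
      rcases h with h | h <;> rcases h' with h' | h'
      · exact absurd (h'.symm.trans h) hv.2.2.1
      · exact absurd (hself v u (h'.symm.trans h)) hv.2.2.2
      · exact absurd (h'.symm.trans h) hv.2.2.2
      · exact absurd (add_right_cancel (h'.symm.trans h)) hv.2.2.1
    · rintro (h | h)
      · exact ⟨Or.inl h, Or.inl h⟩
      · exact ⟨Or.inr (Or.inl h), Or.inr (Or.inl h)⟩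
  set A : Finset F := {0, 1, u, u + 1} with hA
  set B : Finset F := {0, 1, v, v + 1} with hB
  obtain ⟨hA4, hA0⟩ := plane u hu.1 hu.2
  obtain ⟨hB4, hB0⟩ := plane v hv.1 hv.2.1
  obtain ⟨e, he⟩ := ht.exists_mem_dual_affineCode bs hcard A (by rw [hA4]) hA0
  obtain ⟨f, hf⟩ := ht.exists_mem_dual_affineCode bs hcard B (by rw [hB4]) hB0
  have hprod := two_mul_mul_mem_of_isLinear hlin he hf
  have hind : 2 * ((indicatorWord red t A - 2 * e) * (indicatorWord red t B - 2 * f)) =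
      (2 : ZMod 4) • indicatorWord red t (A ∩ B) := by
    have h1 : ∀ a b c d : ZMod 4, 2 * ((a - 2 * c) * (b - 2 * d)) = 2 * (a * b) := by decide
    funext j
    refine (h1 _ _ _ _).trans ?_
    simp only [indicatorWord, Pi.smul_apply, smul_eq_mul, Finset.mem_inter]
    by_cases hjA : red (t j) ∈ A <;> by_cases hjB : red (t j) ∈ B <;> simp [hjA, hjB]
  rw [hind, mem_dual_affineCode_iff] at hprod
  have hsum : 2 * ∑ j, indicatorWord red t (A ∩ B) j • t j = 0 := by
    rw [← hprod.2, Finset.mul_sum]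
    refine Finset.sum_congr rfl fun j _ => ?_
    rw [Pi.smul_apply, smul_assoc, Algebra.smul_def (2 : ZMod 4)]
    congr 1
    exact (map_ofNat _ 2).symm
  have h0 := (ht.red_eq_zero_iff _).2 ((two_mul_eq_zero_iff bs _).1 hsum)
  rw [ht.red_sum_indicatorWord, hinter, Finset.sum_pair zero_ne_one, zero_add] at h0
  exact one_ne_zero h0

end IsTeichmuller

end

/-! ### The Galois ring `ℤ₄[X] / (h)` -/

namespace IsPrimitiveBasicIrreducible

variable {m : ℕ} {h : (ZMod 4)[X]}

/-- Reduction modulo `2`. -/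
abbrev mod2 : ZMod 4 →+* ZMod 2 := ZMod.castHom (by decide : 2 ∣ 4) (ZMod 2)

/-- The residue map of `ℤ₄[X] / (h)`. -/
noncomputable def residue (h : (ZMod 4)[X]) : AdjoinRoot h →+* AdjoinRoot (h.map mod2) :=
  AdjoinRoot.map mod2 h (h.map mod2) dvd_rfl

theorem residue_mk (f : (ZMod 4)[X]) :
    residue h (AdjoinRoot.mk h f) = AdjoinRoot.mk (h.map mod2) (f.map mod2) := by
  induction f using Polynomial.induction_on' with
  | add f g hf hg => rw [map_add, map_add, hf, hg, Polynomial.map_add, map_add]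
  | monomial n a =>
    rw [← C_mul_X_pow_eq_monomial]
    simp only [map_mul, map_pow, AdjoinRoot.mk_X, AdjoinRoot.mk_C, Polynomial.map_mul,
      Polynomial.map_pow, Polynomial.map_C, Polynomial.map_X]
    rw [residue, AdjoinRoot.map_root, AdjoinRoot.map_of]

theorem residue_eq_zero_iff (x : AdjoinRoot h) : residue h x = 0 ↔ ∃ y, x = 2 * y := by
  have hcoeff : ∀ a : ZMod 4, mod2 a = 0 → (2 : ZMod 4) ∣ a := by
    have : ∀ a : ZMod 4, mod2 a = 0 → ∃ c, a = 2 * c := by decide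
    exact this
  constructor
  · intro hx
    obtain ⟨f, rfl⟩ := AdjoinRoot.mk_surjective x
    rw [residue_mk, AdjoinRoot.mk_eq_zero] at hx
    obtain ⟨k, hk⟩ := hx
    obtain ⟨k, rfl⟩ := Polynomial.map_surjective mod2 (ZMod.ringHom_surjective _) k
    obtain ⟨g, hg⟩ : C (2 : ZMod 4) ∣ f - h * k := by
      rw [C_dvd_iff_dvd_coeff]
      intro i
      refine hcoeff _ ?_
      rw [← coeff_map, Polynomial.map_sub, Polynomial.map_mul, hk, sub_self, coeff_zero]
    refine ⟨AdjoinRoot.mk h g, ?_⟩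
    have h1 := congrArg (AdjoinRoot.mk h) hg
    rw [map_sub, map_mul, AdjoinRoot.mk_self, zero_mul, sub_zero, map_mul] at h1
    rw [h1]
    congr 1
  · rintro ⟨y, rfl⟩
    have h2 : (2 : AdjoinRoot (h.map mod2)) = 0 := by
      rw [← map_ofNat (AdjoinRoot.of (h.map mod2)) 2, show (OfNat.ofNat 2 : ZMod 2) = 0 by decide,
        map_zero]
    rw [map_mul, map_ofNat, h2, zero_mul]

theorem irreducible_map (hh : IsPrimitiveBasicIrreducible m h) :
    Irreducible (h.map mod2) := hh.reduction.2.1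

/-- A basis of `ℤ₄[X] / (h)` over `ℤ₄`. -/
noncomputable def basis (hh : IsPrimitiveBasicIrreducible m h) :
    Module.Basis (Fin m) (ZMod 4) (AdjoinRoot h) :=
  (AdjoinRoot.powerBasis' hh.monic).basis.reindex
    (finCongr ((AdjoinRoot.powerBasis'_dim hh.monic).trans hh.natDegree_eq))

theorem card_coordinates (m : ℕ) : Fintype.card (Option (Fin (2 ^ m - 1))) = 2 ^ m := by
  rw [Fintype.card_option, Fintype.card_fin, Nat.sub_add_cancel Nat.one_le_two_pow]

theorem isTeichmuller (hh : IsPrimitiveBasicIrreducible m h) (hm : 2 ≤ m)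
    [Fact (Irreducible (h.map mod2))] : IsTeichmuller (residue h) (teichmuller m h) where
  red_eq_zero_iff := residue_eq_zero_iff
  bijective := by
    have hN : 4 ≤ 2 ^ m := by
      calc 4 = 2 ^ 2 := by norm_num
        _ ≤ 2 ^ m := Nat.pow_le_pow_right (by norm_num) hm
    obtain ⟨hdeg, hirr, hord⟩ := hh.reduction
    have hcardF : Nat.card (AdjoinRoot (h.map mod2)) = 2 ^ m := by
      have := (AdjoinRoot.powerBasis hirr.ne_zero).finite
      rw [Module.natCard_eq_pow_finrank (K := ZMod 2), Nat.card_zmod,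
        (AdjoinRoot.powerBasis hirr.ne_zero).finrank, AdjoinRoot.powerBasis_dim]
      exact congrArg (2 ^ ·) hdeg
    have hfin : Finite (AdjoinRoot (h.map mod2)) :=
      Nat.finite_of_card_ne_zero (by rw [hcardF]; positivity)
    have hroot : (AdjoinRoot.root (h.map mod2)) ^ (2 ^ m - 1) = 1 := by
      rw [← hord]
      exact pow_orderOf_eq_one _
    have hne : AdjoinRoot.root (h.map mod2) ≠ 0 := by
      intro h0
      rw [h0, zero_pow (by omega)] at hroot
      exact zero_ne_one hroot
    have hres : ∀ i : Fin (2 ^ m - 1), residue h (teichmuller m h (some i)) =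
        AdjoinRoot.root (h.map mod2) ^ (i : ℕ) := by
      intro i
      change residue h (AdjoinRoot.root h ^ (i : ℕ)) = _
      rw [map_pow, residue, AdjoinRoot.map_root]
    have hres0 : residue h (teichmuller m h none) = 0 := map_zero _
    refine Function.Injective.bijective_of_nat_card_le ?_ ?_
    · rintro (_ | i) (_ | j) hij
      · rfl
      · exact absurd ((hres j).symm.trans (hij.symm.trans hres0)) (pow_ne_zero _ hne)
      · exact absurd ((hres i).symm.trans (hij.trans hres0)) (pow_ne_zero _ hne)
      · have h1 := (hres i).symm.trans (hij.trans (hres j))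
        have h2 := pow_injOn_Iio_orderOf (x := AdjoinRoot.root (h.map mod2))
          (show (i : ℕ) ∈ Set.Iio _ by rw [Set.mem_Iio, hord]; exact i.2)
          (show (j : ℕ) ∈ Set.Iio _ by rw [Set.mem_Iio, hord]; exact j.2) h1
        exact congrArg some (Fin.ext h2)
    · rw [hcardF, Nat.card_eq_fintype_card, card_coordinates]
  isSquare := by
    rintro (_ | i)
    · exact ⟨0, by simp [teichmuller]⟩
    · refine ⟨AdjoinRoot.root h ^ ((i : ℕ) * 2 ^ (m - 1)), ?_⟩
      -- the order `2^m - 1` of `ξ` is odd, so that `ξ = (ξ^(2^(m-1)))²`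
      have h1 : (i : ℕ) * 2 ^ (m - 1) * 2 = (2 ^ m - 1) * i + i := by
        rw [mul_assoc, ← pow_succ, Nat.sub_add_cancel (by omega : 1 ≤ m), ← Nat.succ_mul,
          Nat.succ_eq_add_one, Nat.sub_add_cancel Nat.one_le_two_pow, mul_comm]
      rw [← pow_mul, h1, pow_add, pow_mul, hh.root_pow_eq_one, one_pow, one_mul]
      rfl

end IsPrimitiveBasicIrreducible

end QuaternaryCode

theorem theorem5p1 (m : ℕ) (hm : 2 ≤ m) (h : (ZMod 4)[X])
    (hh : IsPrimitiveBasicIrreducible m h) :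
    preparata m h = dual (kerdock m h) ∧
    (Odd m →
      blockLength (binaryImage (preparata m h)) = 2 ^ (m + 1) ∧
      ¬ IsLinear (binaryImage (preparata m h)) ∧
      (binaryImage (preparata m h)).ncard = 2 ^ (2 ^ (m + 1) - 2 * m - 2) ∧
      HasMinDistance (binaryImage (preparata m h)) 6 ∧
      IsDistanceInvariant (binaryImage (preparata m h)) ∧
      IsMacWilliamsTransform (2 ^ (m + 1))
        (weightDistribution (binaryImage (preparata m h)))
        (weightDistribution (binaryImage (kerdock m h))) ∧
      ∀ (F : Type) [Field F] [Fintype F] [Algebra (ZMod 2) F], Fintype.card F = 2 ^ m →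
        weightDistribution (binaryImage (preparata m h)) =
          weightDistribution (originalPreparata F)) := by
  refine ⟨preparata_eq_dual_kerdock hm hh, fun hodd => ?_⟩
  obtain ⟨k, hk⟩ := hodd
  have : Fact (Irreducible (h.map IsPrimitiveBasicIrreducible.mod2)) := ⟨hh.irreducible_map⟩
  have ht := hh.isTeichmuller hm
  have hcard := IsPrimitiveBasicIrreducible.card_coordinates m
  have hN : 2 ^ m = 2 ^ (2 * k + 1) := by rw [hk]
  have hlen : Fintype.card (Option (Fin (2 ^ m - 1)) ⊕ Option (Fin (2 ^ m - 1))) = 2 ^ (m + 1) := by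
    rw [Fintype.card_sum, hcard, pow_succ, mul_two]
  have hdual : preparata m h = dual (affineCode (teichmuller m h)) := by
    rw [← kerdock_eq_affineCode hm hh, preparata_eq_dual_kerdock hm hh]
  have henum : HasPreparataEnumerator (binaryImage (preparata m h)) k (2 ^ m) := by
    rw [hdual]
    exact hasPreparataEnumerator_dual_affineCode ht hh.basis hcard rfl hk
  obtain ⟨hlow, h6⟩ := henum.weightDistribution_low hN (by omega)
  refine ⟨hlen, ?_, ?_, hasMinDistance_binaryImage _ (by norm_num) hlow h6,
    isDistanceInvariant_binaryImage _, ?_, ?_⟩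
  · rw [hdual]
    exact ht.not_isLinear hh.basis hcard (by omega)
  · rw [henum.ncard_eq hN, ← hk, pow_succ, mul_comm (2 ^ m), Nat.sub_sub]
  · refine isMacWilliamsTransform_of_weightEnum hlen hlen ⟨0, zero_mem_binaryImage _⟩ fun w z => ?_
    rw [preparata_eq_dual_kerdock hm hh]
    exact weightEnum_dual _ w z
  · intro F _ _ _ hF
    refine weightDistribution_eq_of_weightEnum fun z => ?_
    have h0 : 4 * ((2 ^ m : ℕ) : ℂ) ^ 2 ≠ 0 := by
      refine mul_ne_zero (by norm_num) (pow_ne_zero 2 ?_)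
      exact_mod_cast (pow_pos two_pos m).ne'
    exact mul_left_cancel₀ h0 ((henum 1 z).trans 
      (hasPreparataEnumerator_originalPreparata hF hN 1 z).symm)
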